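/- Let $D$ be a finite-dimensional central division algebra of degree $d$ over a field $C$ (so $[D:C]=d^2$), and let $\sigma$ be a ring automorphism of $D$ of finite order $n>1$ modulo inner automorphisms: $\sigma^n(z)=uzu^{-1}$ for all $z\in D$, where $u\in D^\times$ is chosen with $\sigma(u)=u$, and $\sigma^j$ is not inner for $0<j<n$. Let $R=D[t;\sigma]$ be the skew polynomial ring with $ta=\sigma(a)t$, and let $F=C\cap\mathrm{Fix}(\sigma)$. Let $\rho$ be a ring automorphism of $D$, put $F'=F\cap\mathrm{Fix}(\rho)$, assume that $F/F'$ is finite-dimensional, and let $\nu\in D$. Let $f\in R$ be monic and irreducible of degree $m>1$ such that every common right divisor of $f$ and $t$ is a unit. Let $h(t)=\hat h(u^{-1}t^n)$ be the minimal central left multiple of $f$, i.e. $\hat h\in F[x]$ is the monic polynomial of least degree with $\hat h(u^{-1}t^n)\in Rf$. Put $E_{\hat h}=F[x]/(\hat h)$, let $V_f=R/Rf$, and let $E_f=\{z+Rf : z\in F[u^{-1}t^n]\}$, which acts on $V_f$ by $(a+Rf)(z+Rf)=az+Rf$. For $a\in R$ let $L_a(b+Rf)=ab+Rf$. For a positive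 integer $l$ let $$A=\{d_0+d_1t+\dots+d_{lm-1}t^{lm-1}+\nu\rho(d_0)t^{lm} : d_i\in D\},\qquad S_{n,m,l}(\nu,\rho,f)=\{a+Rh : a\in A\}\subseteq R/Rh,$$ and let $\mathcal C=\{L_a : a\in A\}\subseteq \mathrm{End}_{E_f}(V_f)\subseteq\mathrm{End}_F(V_f)$ be the corresponding code ($L_a$ depends only on $a+Rh$). Let $\mathcal E$ be any $F$-algebra with $\mathrm{End}_{E_f}(V_f)\subseteq\mathcal E\subseteq\mathrm{End}_F(V_f)$ (for example either end), and put $$I_l(\mathcal C)=\{\Phi\in\mathcal E : \Phi\mathcal C\subseteq\mathcal C\},\quad I_r(\mathcal C)=\{\Phi\in\mathcal E : \mathcal C\Phi\subseteq\mathcal C\},\quad C(\mathcal C)=\{\Phi\in\mathcal E : \Phi M=M\Phi\ \ \forall M\in\mathcal C\},\quad Z(\mathcal C)=I_l(\mathcal C)\cap C(\mathcal C).$$ Theorem. Suppose that $\deg h=dmn$, $l\le dn/2$ and $lm>2$. Then $\mathcal C\subseteq\mathrm{End}_{E_f}(V_f)$, and the following hold, where the isomorphisms with $C(\mathcal C)$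 are isomorphisms of $F$-algebras and all others are isomorphisms of $F'$-algebras. If $\nu\ne 0$: (i) $I_l(\mathcal C)\cong\{g\in D : g\nu=\nu\rho(g)\}$; in particular $I_l(\mathcal C)\cong\mathrm{Fix}(\rho)$ if $\nu\in C$; (ii) $I_r(\mathcal C)\cong\mathrm{Fix}(\rho^{-1}\circ\sigma^{lm})\subseteq D$; (iii) $C(\mathcal C)\cong E_{\hat h}$ and $Z(\mathcal C)\cong F'$. If $\nu=0$: (iv) $I_l(\mathcal C)\cong D$ and $I_r(\mathcal C)\cong D$; (v) $C(\mathcal C)\cong E_{\hat h}$ and $Z(\mathcal C)\cong F$. -/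

import Mathlib

open Polynomial

noncomputable section

namespace SkewCode

/-! ### The skew polynomial ring `D[t;σ]` -/

section SkewPoly

variable {D : Type*} [DivisionRing D]

/-- The action of the free monoid on one generator on `D` in which the generator acts as `σ`. -/
abbrev skewAction (σ : D ≃+* D) : MulSemiringAction (Multiplicative ℕ) D :=
  MulSemiringAction.compHom D (powersHom (RingAut D) σ)

/-- The skew polynomial ring `R = D[t;σ]`: polynomials `∑ aᵢ tⁱ` with coefficients on the left,
with multiplication determined by `t * a = σ(a) * t`. It is Mathlib's `SkewPolynomial D`, with
the ring structure that belongs to the action of `σ`. -/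
def SkewPoly (_σ : D ≃+* D) : Type _ := SkewPolynomial D

variable {σ : D ≃+* D}

instance : Ring (SkewPoly σ) :=
  letI := skewAction σ
  inferInstanceAs (Ring (SkewPolynomial D))

/-- The coefficient of `tⁱ`. -/
def SkewPoly.coeff (p : SkewPoly σ) (i : ℕ) : D := SkewPolynomial.coeff (R := D) p i

/-- The degree of a skew polynomial, with `deg 0 = ⊥` (that is, `-∞`). -/
def SkewPoly.degree (p : SkewPoly σ) : WithBot ℕ := (SkewPolynomial.support (R := D) p).max

/-- The monomial `a tⁱ`, additive in `a`. -/
def SkewPoly.monomial (σ : D ≃+* D) (i : ℕ) : D →+ SkewPoly σ :=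
  (SkewPolynomial.monomial (R := D) i).toAddMonoidHom

/-- The constant skew polynomials, as an embedding of `D` into `D[t;σ]`. -/
def SkewPoly.const (σ : D ≃+* D) : D →+* SkewPoly σ :=
  letI := skewAction σ
  SkewPolynomial.CRingHom (R := D)

/-- The variable `t`. -/
def SkewPoly.t (σ : D ≃+* D) : SkewPoly σ := SkewPoly.monomial σ 1 1

theorem SkewPoly.monomial_mul_monomial (σ : D ≃+* D) (i j : ℕ) (a b : D) :
    SkewPoly.monomial σ i a * SkewPoly.monomial σ j b =
      SkewPoly.monomial σ (i + j) (a * (σ ^ i : D ≃+* D) b) := by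
  let := skewAction σ
  have h := SkewPolynomial.monomial_mul_monomial (R := D) i j a b
  rw [SkewPolynomial.φ_iterate_apply] at h
  exact h

theorem SkewPoly.const_eq (σ : D ≃+* D) (a : D) :
    SkewPoly.const σ a = SkewPoly.monomial σ 0 a := rfl

theorem SkewPoly.induction {motive : SkewPoly σ → Prop} (p : SkewPoly σ) (h0 : motive 0)
    (ha : ∀ i a q, motive q → motive (SkewPoly.monomial σ i a + q)) : motive p :=
  SkewPolynomial.induction (R := D) (motive := motive) p h0 fun i a q _ _ hq => ha i a q hq

/-- `t * a = σ(a) * t`. -/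
theorem SkewPoly.t_mul_const (σ : D ≃+* D) (a : D) :
    SkewPoly.t σ * SkewPoly.const σ a = SkewPoly.const σ (σ a) * SkewPoly.t σ := by
  simp [SkewPoly.t, SkewPoly.const_eq, SkewPoly.monomial_mul_monomial]

/-- `a tⁱ` is the product of the constant `a` and `tⁱ`. -/
theorem SkewPoly.monomial_eq (σ : D ≃+* D) (i : ℕ) (a : D) :
    SkewPoly.monomial σ i a = SkewPoly.const σ a * SkewPoly.t σ ^ i := by
  have ht : SkewPoly.t σ ^ i = SkewPoly.monomial σ i 1 := by
    induction i with
    | zero => rfl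
    | succ k ih => rw [pow_succ, ih, SkewPoly.t, SkewPoly.monomial_mul_monomial]; simp
  rw [ht, SkewPoly.const_eq, SkewPoly.monomial_mul_monomial]
  simp

/-- `(f,g)_r = 1`: every common right divisor of `f` and `g` is a unit. -/
def RightCoprime (f g : SkewPoly σ) : Prop :=
  ∀ c : SkewPoly σ, (∃ a, f = a * c) → (∃ b, g = b * c) → IsUnit c

/-- `τ` is an inner automorphism of `D`. -/
def IsInnerAut (τ : D ≃+* D) : Prop := ∃ v : D, v ≠ 0 ∧ ∀ z, τ z = v * z * v⁻¹

end SkewPoly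

/-! ### The fields `F = C ∩ Fix(σ)` and `F' = F ∩ Fix(ρ)` -/

section Fields

variable (C : Type*) {D : Type*} [Field C] [DivisionRing D] [Algebra C D]

/-- `F = C ∩ Fix(σ)`, as a subfield of `C`. -/
def fixF (σ : D ≃+* D) : Subfield C where
  carrier := {c | σ (algebraMap C D c) = algebraMap C D c}
  mul_mem' {a b} ha hb := by simp_all
  one_mem' := by simp
  add_mem' {a b} ha hb := by simp_all
  zero_mem' := by simp
  neg_mem' {a} ha := by simp_all
  inv_mem' a ha := by simp_all

/-- `F' = F ∩ Fix(ρ)`, as a subfield of `F`. -/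
def fixF' (σ ρ : D ≃+* D) : Subfield (fixF C σ) where
  carrier := {c | ρ (algebraMap (fixF C σ) D c) = algebraMap (fixF C σ) D c}
  mul_mem' {a b} ha hb := by simp_all
  one_mem' := by simp
  add_mem' {a b} ha hb := by simp_all
  zero_mem' := by simp
  neg_mem' {a} ha := by simp_all
  inv_mem' a ha := by simp_all

variable {C}

theorem σ_algebraMap {σ : D ≃+* D} (c : fixF C σ) :
    σ (algebraMap (fixF C σ) D c) = algebraMap (fixF C σ) D c := c.2

theorem ρ_algebraMap {σ ρ : D ≃+* D} (c : fixF' C σ ρ) :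
    ρ (algebraMap (fixF' C σ ρ) D c) = algebraMap (fixF' C σ ρ) D c := c.2

theorem σ_algebraMap' {σ ρ : D ≃+* D} (c : fixF' C σ ρ) :
    σ (algebraMap (fixF' C σ ρ) D c) = algebraMap (fixF' C σ ρ) D c := c.1.2

theorem pow_σ_algebraMap {σ : D ≃+* D} (i : ℕ) (c : fixF C σ) :
    (σ ^ i : D ≃+* D) (algebraMap (fixF C σ) D c) = algebraMap (fixF C σ) D c := by
  induction i with
  | zero => rfl
  | succ k ih => rw [pow_succ, RingAut.mul_apply, σ_algebraMap, ih]

/-- `D[t;σ]` is an `F`-algebra through the constants. -/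
instance (σ : D ≃+* D) : Algebra (fixF C σ) (SkewPoly σ) :=
  ((SkewPoly.const σ).comp (algebraMap (fixF C σ) D)).toAlgebra' fun c p => by
    induction p using SkewPoly.induction with
    | h0 => simp
    | ha i a q hq =>
      rw [mul_add, add_mul, hq]
      congr 1
      simp only [RingHom.comp_apply, SkewPoly.const_eq, SkewPoly.monomial_mul_monomial,
        pow_σ_algebraMap]
      simp [Algebra.commutes]

theorem algebraMap_skewPoly {σ : D ≃+* D} (c : fixF C σ) :
    algebraMap (fixF C σ) (SkewPoly σ) c = SkewPoly.const σ (algebraMap (fixF C σ) D c) := rfl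

theorem smul_monomial {σ : D ≃+* D} (c : fixF C σ) (i : ℕ) (a : D) :
    c • SkewPoly.monomial σ i a = SkewPoly.monomial σ i (c • a) := by
  rw [Algebra.smul_def, algebraMap_skewPoly, SkewPoly.const_eq, SkewPoly.monomial_mul_monomial,
    Algebra.smul_def]
  simp

/-- `Fix(τ)` as an `F'`-algebra, for an automorphism `τ` of `D` that fixes `F'`. -/
def fixAlg (σ ρ τ : D ≃+* D)
    (hτ : ∀ c : fixF' C σ ρ, τ (algebraMap (fixF' C σ ρ) D c) = algebraMap (fixF' C σ ρ) D c) :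
    Subalgebra (fixF' C σ ρ) D where
  carrier := {g | τ g = g}
  mul_mem' {a b} ha hb := by simp_all
  add_mem' {a b} ha hb := by simp_all
  algebraMap_mem' c := hτ c

variable (C)

/-- `Fix(ρ)`. -/
def fixRho (σ ρ : D ≃+* D) : Subalgebra (fixF' C σ ρ) D := fixAlg σ ρ ρ ρ_algebraMap

/-- `Fix(ρ⁻¹ ∘ σʲ)`. -/
def fixRhoInvSigmaPow (σ ρ : D ≃+* D) (j : ℕ) : Subalgebra (fixF' C σ ρ) D :=
  fixAlg σ ρ (ρ⁻¹ * σ ^ j) fun c => by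
    rw [RingAut.mul_apply]
    have h : (σ ^ j : D ≃+* D) (algebraMap (fixF' C σ ρ) D c) = algebraMap (fixF' C σ ρ) D c :=
      pow_σ_algebraMap j c.1
    rw [h]
    exact (RingEquiv.symm_apply_eq ρ).2 (ρ_algebraMap c).symm

/-- `{g ∈ D : g ν = ν ρ(g)}`. -/
def twistedFix (σ ρ : D ≃+* D) (ν : D) : Subalgebra (fixF' C σ ρ) D where
  carrier := {g | g * ν = ν * ρ g}
  mul_mem' {a b} ha hb := by
    simp only [Set.mem_ofPred_eq, map_mul] at *
    rw [mul_assoc, hb, ← mul_assoc, ha, mul_assoc]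
  add_mem' {a b} ha hb := by
    simp only [Set.mem_ofPred_eq, map_add] at *
    rw [add_mul, ha, hb, mul_add]
  algebraMap_mem' c := by
    simp only [Set.mem_ofPred_eq]
    rw [ρ_algebraMap, Algebra.commutes]

end Fields

/-! ### The minimal central left multiple -/

section MCLM

variable {C D : Type*} [Field C] [DivisionRing D] [Algebra C D]

/-- For `p ∈ F[x]`, the element `p(u⁻¹tⁿ)` of `D[t;σ]`. -/
def evalCentral (σ : D ≃+* D) (u : D) (n : ℕ) (p : (fixF C σ)[X]) : SkewPoly σ :=
  aeval (SkewPoly.const σ u⁻¹ * SkewPoly.t σ ^ n) p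

/-- `h(t) = ĥ(u⁻¹tⁿ)` is the minimal central left multiple of `f`: `ĥ ∈ F[x]` is monic,
`h ∈ Rf`, and `ĥ` has the smallest degree with these properties. -/
structure IsMCLM {σ : D ≃+* D} (u : D) (n : ℕ) (f : SkewPoly σ) (hhat : (fixF C σ)[X]) :
    Prop where
  monic : hhat.Monic
  left_multiple : ∃ g, evalCentral σ u n hhat = g * f
  minimal : ∀ p : (fixF C σ)[X], p.Monic → (∃ g, evalCentral σ u n p = g * f) →
    hhat.natDegree ≤ p.natDegree

end MCLM

/-! ### The code -/

section Code

variable {C D : Type*} [Field C] [DivisionRing D] [Algebra C D]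

/-- `V_f = R/Rf`, a left `R`-module (and so an `F`-vector space). -/
abbrev Vf {σ : D ≃+* D} (f : SkewPoly σ) : Type _ :=
  SkewPoly σ ⧸ Submodule.span (SkewPoly σ) {f}

variable (C) in
/-- The map `a ↦ L_a`, `L_a(b + Rf) = ab + Rf`, from `R` to `End_F(V_f)`. -/
def leftMul {σ : D ≃+* D} (f : SkewPoly σ) :
    SkewPoly σ →ₐ[fixF C σ] Module.End (fixF C σ) (Vf f) :=
  Algebra.lsmul (fixF C σ) (fixF C σ) (Vf f)

theorem leftMul_mk {σ : D ≃+* D} (f a b : SkewPoly σ) :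
    leftMul C f a (Submodule.Quotient.mk b) = Submodule.Quotient.mk (a * b) := rfl

variable (C) in
/-- `End_{E_f}(V_f)` as a subalgebra of `End_F(V_f)`. Here `E_f = {z + Rf : z ∈ F[u⁻¹tⁿ]}` acts on
`V_f` by `(a + Rf)(z + Rf) = az + Rf`; as `z` is central, this is `za + Rf = L_z(a + Rf)`, so
that `E_f`-linearity means to commute with all `L_z`, `z ∈ F[u⁻¹tⁿ]`. -/
def endEf {σ : D ≃+* D} (u : D) (n : ℕ) (f : SkewPoly σ) :
    Subalgebra (fixF C σ) (Module.End (fixF C σ) (Vf f)) :=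
  Subalgebra.centralizer (fixF C σ)
    (Set.range fun z : (fixF C σ)[X] => leftMul C f (evalCentral σ u n z))

variable (C) in
/-- `A = {d₀ + d₁t + ⋯ + d_{lm-1}t^{lm-1} + νρ(d₀)t^{lm} : dᵢ ∈ D}`, an `F'`-subspace of `R`. -/
def setA (σ ρ : D ≃+* D) (ν : D) (l m : ℕ) : Submodule (fixF' C σ ρ) (SkewPoly σ) where
  carrier := {a | ∃ d : ℕ → D, a = (∑ i ∈ Finset.range (l * m), SkewPoly.monomial σ i (d i)) +
    SkewPoly.monomial σ (l * m) (ν * ρ (d 0))}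
  add_mem' := by
    rintro _ _ ⟨d, rfl⟩ ⟨e, rfl⟩
    refine ⟨d + e, ?_⟩
    simp only [Pi.add_apply, map_add, mul_add, Finset.sum_add_distrib]
    abel
  zero_mem' := ⟨0, by simp⟩
  smul_mem' := by
    rintro c _ ⟨d, rfl⟩
    refine ⟨fun i => c • d i, ?_⟩
    have h1 : ∀ (i : ℕ) (a : D), c • SkewPoly.monomial σ i a = SkewPoly.monomial σ i (c • a) :=
      fun i a => smul_monomial c.1 i a
    have h2 : ν * ρ (c • d 0) = c • (ν * ρ (d 0)) := by
      rw [Algebra.smul_def, map_mul, ρ_algebraMap, ← mul_assoc, ← Algebra.commutes, mul_assoc,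
        ← Algebra.smul_def]
    rw [smul_add, Finset.smul_sum, h1, h2]
    simp only [h1]

variable (C) in
/-- The code `𝒞 = {L_a : a ∈ A}` of `S_{n,m,l}(ν,ρ,f) = {a + Rh : a ∈ A} ⊆ R/Rh`, an `F'`-linear
set of endomorphisms of `V_f`. As `Rh` annihilates `V_f`, the map `L_a` depends only on the class
`a + Rh`. -/
def code {σ : D ≃+* D} (ρ : D ≃+* D) (ν : D) (l m : ℕ) (f : SkewPoly σ) :
    Submodule (fixF' C σ ρ) (Module.End (fixF C σ) (Vf f)) :=
  (setA C σ ρ ν l m).map ((leftMul C f).toLinearMap.restrictScalars (fixF' C σ ρ))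

end Code

/-! ### Idealisers, centraliser and centre of a code -/

section Idealisers

variable {K E : Type*} [CommRing K] [Ring E] [Algebra K E]

/-- The left idealiser `I_l(𝒞) = {Φ ∈ 𝓔 : Φ𝒞 ⊆ 𝒞}` in the ambient algebra `𝓔`. -/
def leftIdealiser (𝓔 : Subalgebra K E) (𝒞 : Submodule K E) : Subalgebra K E where
  carrier := {Φ | Φ ∈ 𝓔 ∧ ∀ M ∈ 𝒞, Φ * M ∈ 𝒞}
  mul_mem' {a b} ha hb := ⟨mul_mem ha.1 hb.1, fun M hM => by
    rw [mul_assoc]; exact ha.2 _ (hb.2 _ hM)⟩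
  add_mem' {a b} ha hb := ⟨add_mem ha.1 hb.1, fun M hM => by
    rw [add_mul]; exact add_mem (ha.2 _ hM) (hb.2 _ hM)⟩
  algebraMap_mem' c := ⟨𝓔.algebraMap_mem c, fun M hM => by
    rw [← Algebra.smul_def]; exact 𝒞.smul_mem c hM⟩

/-- The right idealiser `I_r(𝒞) = {Φ ∈ 𝓔 : 𝒞Φ ⊆ 𝒞}` in the ambient algebra `𝓔`. -/
def rightIdealiser (𝓔 : Subalgebra K E) (𝒞 : Submodule K E) : Subalgebra K E where
  carrier := {Φ | Φ ∈ 𝓔 ∧ ∀ M ∈ 𝒞, M * Φ ∈ 𝒞}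
  mul_mem' {a b} ha hb := ⟨mul_mem ha.1 hb.1, fun M hM => by
    rw [← mul_assoc]; exact hb.2 _ (ha.2 _ hM)⟩
  add_mem' {a b} ha hb := ⟨add_mem ha.1 hb.1, fun M hM => by
    rw [mul_add]; exact add_mem (ha.2 _ hM) (hb.2 _ hM)⟩
  algebraMap_mem' c := ⟨𝓔.algebraMap_mem c, fun M hM => by
    rw [← Algebra.commutes, ← Algebra.smul_def]; exact 𝒞.smul_mem c hM⟩

/-- The centraliser `C(𝒞) = {Φ ∈ 𝓔 : ΦM = MΦ for all M ∈ 𝒞}` in the ambient algebra `𝓔`. -/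
def centraliser (𝓔 : Subalgebra K E) (𝒞 : Set E) : Subalgebra K E :=
  𝓔 ⊓ Subalgebra.centralizer K 𝒞

/-- The centre `Z(𝒞) = I_l(𝒞) ∩ C(𝒞)`. -/
def centre (𝓔 : Subalgebra K E) (𝒞 : Submodule K E) : Subalgebra K E :=
  leftIdealiser 𝓔 𝒞 ⊓ centraliser 𝓔 𝒞

end Idealisers

end SkewCode

end

/-! Why the theorem holds. The ring `R` acts on the simple module `V_f = R/Rf`, and two facts about
this action carry the proof. First, `L_t` is bijective, since `t` is normal and does not kill `V_f`;
so `t` can be cancelled in identities between operators. Second, `a ↦ L_a` is injective in degrees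
below `deg h = dmn` (`eq_zero_of_leftMul_eq_zero`): a nonzero annihilating polynomial of least
degree is, up to a constant, a polynomial in the central element `u⁻¹tⁿ`, hence comes from a
multiple of `ĥ`. As `2lm ≤ dmn`, the operator identities below can be read coefficient by
coefficient.

Left idealiser: if `ν = 0`, the identity lies in the code, so `Φ` is some `L_b` with `deg b < lm`.
If `ν ≠ 0`, then `ΦL_t = L_a` and `ΦL_{t²} = L_{a'}` give `at = a'`; the degree bound kills the top
coefficient of `a`, hence also its constant one, so `a = bt` and `Φ = L_b`. Testing `Φ` on
`t^{lm-1}` makes `b` a constant, and testing it on `1 + νt^{lm}` gives the condition on this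
constant. The right idealiser is the mirror image, with a twist by `σ^{lm}`.

Centraliser: what commutes with the code commutes with `R`. The polynomials of degree below `dmn`
form an `F`-space of `E_ĥ`-linear maps of `V_f` at least as large as `End_{E_ĥ}(V_f)`, so they fill
it, and its centre is `E_ĥ`. The count needs only the upper bounds `[C:F] ≤ n` and `dim_F V_f ≤
m[D:F]`.

Centre: a constant that commutes with `R` lies in `F`; for `ν ≠ 0` the idealiser condition puts it
in `F'`. All operators found are of the form `L_a`, hence `E_f`-linear, so the choice of `𝓔` is
immaterial. -/

noncomputable section

namespace SkewCode

/-! ### Coefficients, division and left ideals in `D[t;σ]` -/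

section Coefficients

variable {D : Type*} [DivisionRing D] {σ : D ≃+* D}

namespace SkewPoly

theorem coeff_add (p q : SkewPoly σ) (i : ℕ) : (p + q).coeff i = p.coeff i + q.coeff i :=
  SkewPolynomial.coeff_add (R := D) p q i

variable (σ) in
/-- The `i`-th coefficient as an additive map. -/
def coeffHom (i : ℕ) : SkewPoly σ →+ D where
  toFun p := p.coeff i
  map_zero' := rfl
  map_add' p q := coeff_add p q i

@[simp]
theorem coeff_zero (i : ℕ) : (0 : SkewPoly σ).coeff i = 0 := rfl

theorem coeff_sub (p q : SkewPoly σ) (i : ℕ) : (p - q).coeff i = p.coeff i - q.coeff i :=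
  map_sub (coeffHom σ i) p q

theorem coeff_sum {ι : Type*} (s : Finset ι) (p : ι → SkewPoly σ) (i : ℕ) :
    (∑ j ∈ s, p j).coeff i = ∑ j ∈ s, (p j).coeff i :=
  map_sum (coeffHom σ i) p s

theorem coeff_monomial (i j : ℕ) (a : D) :
    (monomial σ i a).coeff j = if i = j then a else 0 :=
  SkewPolynomial.coeff_monomial (R := D)

@[ext]
theorem ext {p q : SkewPoly σ} (h : ∀ i, p.coeff i = q.coeff i) : p = q :=
  SkewPolynomial.ext (R := D) h

theorem coeff_monomial_mul (i j : ℕ) (a : D) (p : SkewPoly σ) :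
    (monomial σ i a * p).coeff j = if i ≤ j then a * (σ ^ i : D ≃+* D) (p.coeff (j - i)) else 0 := by
  induction p using SkewPoly.induction with
  | h0 => simp
  | ha k b q hq =>
    rw [mul_add, coeff_add, hq, monomial_mul_monomial, coeff_monomial, coeff_add, coeff_monomial]
    by_cases h : i ≤ j
    · simp only [h, if_true, map_add, mul_add]
      congr 1
      by_cases h' : i + k = j
      · rw [if_pos h', if_pos (by omega)]
      · rw [if_neg h', if_neg (by omega)]; simp
    · rw [if_neg h, if_neg (by omega), if_neg h, add_zero]

theorem coeff_mul_monomial (i j : ℕ) (a : D) (p : SkewPoly σ) :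
    (p * monomial σ i a).coeff j =
      if i ≤ j then p.coeff (j - i) * (σ ^ (j - i) : D ≃+* D) a else 0 := by
  induction p using SkewPoly.induction with
  | h0 => simp
  | ha k b q hq =>
    rw [add_mul, coeff_add, hq, monomial_mul_monomial, coeff_monomial, coeff_add, coeff_monomial]
    by_cases h : i ≤ j
    · simp only [h, if_true, add_mul]
      congr 1
      by_cases h' : k + i = j
      · rw [if_pos h', if_pos (by omega)]
        congr 3
        omega
      · rw [if_neg h', if_neg (by omega)]; simp
    · rw [if_neg h, if_neg (by omega), if_neg h, add_zero]

theorem coeff_const_mul (a : D) (p : SkewPoly σ) (j : ℕ) :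
    (const σ a * p).coeff j = a * p.coeff j := by
  rw [const_eq, coeff_monomial_mul]; simp

theorem coeff_mul_const (a : D) (p : SkewPoly σ) (j : ℕ) :
    (p * const σ a).coeff j = p.coeff j * (σ ^ j : D ≃+* D) a := by
  rw [const_eq, coeff_mul_monomial]; simp

theorem coeff_const (a : D) (j : ℕ) : (const σ a).coeff j = if j = 0 then a else 0 := by
  rw [const_eq, coeff_monomial]; simp [eq_comm]

theorem t_pow (i : ℕ) : t σ ^ i = monomial σ i 1 := by
  rw [monomial_eq, map_one, one_mul]

theorem coeff_t_pow (i j : ℕ) : (t σ ^ i).coeff j = if i = j then 1 else 0 := by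
  rw [t_pow, coeff_monomial]

theorem coeff_mul_t_pow (p : SkewPoly σ) (i j : ℕ) :
    (p * t σ ^ i).coeff j = if i ≤ j then p.coeff (j - i) else 0 := by
  rw [t_pow, coeff_mul_monomial]; simp

theorem coeff_t_pow_mul (p : SkewPoly σ) (i j : ℕ) :
    (t σ ^ i * p).coeff j = if i ≤ j then (σ ^ i : D ≃+* D) (p.coeff (j - i)) else 0 := by
  rw [t_pow, coeff_monomial_mul]; simp

/-- `deg p < k`. -/
def DegLT (k : ℕ) (p : SkewPoly σ) : Prop := ∀ i, k ≤ i → p.coeff i = 0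

theorem DegLT.mono {k j : ℕ} {p : SkewPoly σ} (h : DegLT k p) (hkj : k ≤ j) : DegLT j p :=
  fun i hi => h i (hkj.trans hi)

theorem DegLT.sub {k : ℕ} {p q : SkewPoly σ} (hp : DegLT k p) (hq : DegLT k q) :
    DegLT k (p - q) := fun i hi => by rw [coeff_sub, hp i hi, hq i hi, sub_zero]

theorem exists_degLT (p : SkewPoly σ) : ∃ k, DegLT k p := by
  induction p using SkewPoly.induction with
  | h0 => exact ⟨0, fun i _ => rfl⟩
  | ha i a q hq =>
    obtain ⟨k, hk⟩ := hq
    refine ⟨max k (i + 1), fun j hj => ?_⟩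
    rw [coeff_add, coeff_monomial, hk j (by omega), if_neg (by omega), add_zero]

theorem DegLT.eq_sum {k : ℕ} {p : SkewPoly σ} (h : DegLT k p) :
    p = ∑ i ∈ Finset.range k, monomial σ i (p.coeff i) := by
  ext j
  simp only [coeff_sum, coeff_monomial, Finset.sum_ite_eq', Finset.mem_range]
  split_ifs with hj
  · rfl
  · exact h j (not_lt.1 hj)

theorem DegLT.eq_const {p : SkewPoly σ} (h : DegLT 1 p) : p = const σ (p.coeff 0) := by
  conv_lhs => rw [h.eq_sum]
  simp [const_eq]

theorem eq_mul_t_of_coeff_zero {k : ℕ} {p : SkewPoly σ} (h : DegLT (k + 1) p)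
    (h0 : p.coeff 0 = 0) : ∃ q, DegLT k q ∧ p = q * t σ := by
  refine ⟨∑ i ∈ Finset.range k, monomial σ i (p.coeff (i + 1)), fun j hj => ?_, ?_⟩
  · simp only [coeff_sum, coeff_monomial, Finset.sum_ite_eq', Finset.mem_range]
    rw [if_neg (by omega)]
  · ext j
    rw [← pow_one (t σ), coeff_mul_t_pow]
    rcases j with _ | j
    · simpa using h0
    · simp only [coeff_sum, coeff_monomial, Finset.sum_ite_eq', Finset.mem_range]
      by_cases hj : j < k
      · simp [hj]
      · simp [hj, h (j + 1) (by omega)]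

theorem eq_t_mul_of_coeff_zero {k : ℕ} {p : SkewPoly σ} (h : DegLT (k + 1) p)
    (h0 : p.coeff 0 = 0) : ∃ q, DegLT k q ∧ p = t σ * q := by
  refine ⟨∑ i ∈ Finset.range k, monomial σ i (σ.symm (p.coeff (i + 1))), fun j hj => ?_, ?_⟩
  · simp only [coeff_sum, coeff_monomial, Finset.sum_ite_eq', Finset.mem_range]
    rw [if_neg (by omega)]
  · ext j
    rw [← pow_one (t σ), coeff_t_pow_mul]
    rcases j with _ | j
    · simpa using h0
    · simp only [coeff_sum, coeff_monomial, Finset.sum_ite_eq', Finset.mem_range]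
      by_cases hj : j < k
      · simp [hj]
      · simp [hj, h (j + 1) (by omega)]

theorem degLT_of_degree_eq {p : SkewPoly σ} {k : ℕ} (h : p.degree = k) : DegLT (k + 1) p := by
  intro i hi
  by_contra hne
  have hmem : i ∈ SkewPolynomial.support (R := D) p := SkewPolynomial.mem_support_iff.2 hne
  have hle : (i : WithBot ℕ) ≤ p.degree := Finset.le_max hmem
  rw [h] at hle
  have : i ≤ k := by exact_mod_cast hle
  omega

theorem coeff_ne_zero_of_degree_eq {p : SkewPoly σ} {k : ℕ} (h : p.degree = k) :
    p.coeff k ≠ 0 :=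
  SkewPolynomial.mem_support_iff.1 (Finset.mem_of_max (show
    (SkewPolynomial.support (R := D) p).max = (k : WithBot ℕ) from h))

/-- Right division with remainder. -/
theorem exists_eq_mul_add {g : SkewPoly σ} {k : ℕ} (hg : DegLT (k + 1) g) (hgk : g.coeff k ≠ 0)
    (p : SkewPoly σ) : ∃ q r, p = q * g + r ∧ DegLT k r := by
  obtain ⟨N, hN⟩ := exists_degLT p
  induction N generalizing p with
  | zero => exact ⟨0, p, by simp, hN.mono (Nat.zero_le _)⟩
  | succ N ih =>
    by_cases hNk : N < k
    · exact ⟨0, p, by simp, hN.mono hNk⟩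
    · set c := p.coeff N * ((σ ^ (N - k) : D ≃+* D) (g.coeff k))⁻¹
      have hc : c * (σ ^ (N - k) : D ≃+* D) (g.coeff k) = p.coeff N :=
        inv_mul_cancel_right₀ ((map_ne_zero_iff _ (RingEquiv.injective _)).2 hgk) _
      obtain ⟨q, r, hqr, hr⟩ := ih (p - monomial σ (N - k) c * g) fun j hj => by
        rw [coeff_sub, coeff_monomial_mul, if_pos (by omega)]
        rcases hj.eq_or_lt with rfl | hj
        · rw [show N - (N - k) = k by omega, hc, sub_self]
        · rw [hN j hj, hg _ (by omega)]; simp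
      exact ⟨monomial σ (N - k) c + q, r, by rw [add_mul, add_assoc, ← hqr]; abel, hr⟩

/-- Every left ideal of `D[t;σ]` is principal. -/
theorem exists_eq_span_singleton (I : Submodule (SkewPoly σ) (SkewPoly σ)) :
    ∃ g, I = Submodule.span (SkewPoly σ) {g} := by
  classical
  by_cases hI : I = ⊥
  · exact ⟨0, by simp [hI]⟩
  obtain ⟨g₀, hg₀, hg₀'⟩ := I.ne_bot_iff.1 hI
  have hex : ∃ k, ∃ g ∈ I, g ≠ 0 ∧ DegLT k g :=
    (exists_degLT g₀).imp fun k hk => ⟨g₀, hg₀, hg₀', hk⟩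
  obtain ⟨g, hg, hg0, hdeg⟩ := Nat.find_spec hex
  have hmin : ∀ r ∈ I, ∀ k < Nat.find hex, DegLT k r → r = 0 := fun r hr k hk hrk => by
    by_contra hne
    exact Nat.find_min hex hk ⟨r, hr, hne, hrk⟩
  -- `DegLT` is a strict bound, so the least bound is one more than the degree `k` of `g`.
  obtain ⟨k, hk⟩ : ∃ k, Nat.find hex = k + 1 := Nat.exists_eq_succ_of_ne_zero fun h0 => hg0 <| by
    rw [h0] at hdeg
    ext i
    simpa using hdeg i (Nat.zero_le _)
  rw [hk] at hdeg hmin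
  have hgk : g.coeff k ≠ 0 := fun h0 => hg0 <| hmin g hg k (Nat.lt_succ_self k) fun i hi => by
    rcases hi.eq_or_lt with rfl | hi
    · exact h0
    · exact hdeg i hi
  refine ⟨g, le_antisymm (fun p hp => ?_) ((Submodule.span_singleton_le_iff_mem _ _).2 hg)⟩
  obtain ⟨q, r, hqr, hr⟩ := exists_eq_mul_add hdeg hgk p
  have hr0 : r = 0 := hmin r (by
    rw [show r = p - q • g by rw [hqr, smul_eq_mul]; abel]
    exact I.sub_mem hp (I.smul_mem q hg)) k (Nat.lt_succ_self k) hr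
  exact Submodule.mem_span_singleton.2 ⟨q, by rw [hqr, hr0, add_zero, smul_eq_mul]⟩

/-- Left ideals are principal, so an ideal above `Rf` is some `Rg` with `f = ag`, and irreducibility
makes `a` or `g` a unit. -/
theorem isCoatom_span_of_irreducible {f : SkewPoly σ} (hf : Irreducible f) :
    IsCoatom (Submodule.span (SkewPoly σ) {f}) := by
  refine ⟨fun htop => ?_, fun I hI => ?_⟩
  · obtain ⟨c, hc⟩ := Submodule.mem_span_singleton.1
      (htop ▸ Submodule.mem_top : (1 : SkewPoly σ) ∈ Submodule.span (SkewPoly σ) {f})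
    rw [smul_eq_mul] at hc
    -- A left inverse `c` alone does not contradict irreducibility in a noncommutative ring. But
    -- `fc` is idempotent, so if it is a unit it equals 1 and `c` is two-sided.
    have h1 : f = f * c * f := by rw [mul_assoc, hc, mul_one]
    rcases hf.isUnit_or_isUnit h1 with h | h
    · have h2 : f * c * (f * c) = f * c * 1 := by
        rw [← mul_assoc, ← h1, mul_one]
      have h3 : f * c = 1 := h.mul_left_cancel h2
      exact hf.not_isUnit ⟨⟨f, c, h3, hc⟩, rfl⟩
    · exact hf.not_isUnit h
  · obtain ⟨g, rfl⟩ := exists_eq_span_singleton I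
    obtain ⟨a, ha⟩ := Submodule.mem_span_singleton.1
      (hI.le (Submodule.mem_span_singleton_self f))
    rw [smul_eq_mul] at ha
    rcases hf.isUnit_or_isUnit ha.symm with ⟨v, rfl⟩ | ⟨v, rfl⟩
    · refine absurd ((Submodule.span_singleton_le_iff_mem _ _).2 ?_) hI.not_ge
      exact Submodule.mem_span_singleton.2 ⟨(↑v⁻¹ : SkewPoly σ), by
        rw [smul_eq_mul, ← ha, Units.inv_mul_cancel_left]⟩
    · refine (Submodule.eq_top_iff').2 fun p => Submodule.mem_span_singleton.2
        ⟨p * (↑v⁻¹ : SkewPoly σ), ?_⟩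
      rw [smul_eq_mul, mul_assoc, Units.inv_mul, mul_one]

theorem exists_t_mul_eq_mul_t (p : SkewPoly σ) : ∃ q, t σ * p = q * t σ := by
  induction p using SkewPoly.induction with
  | h0 => exact ⟨0, by simp⟩
  | ha i a q hq =>
    obtain ⟨r, hr⟩ := hq
    refine ⟨monomial σ i (σ a) + r, ?_⟩
    rw [mul_add, add_mul, hr, t, monomial_mul_monomial, monomial_mul_monomial, add_comm 1]
    simp

theorem exists_mul_t_eq_t_mul (p : SkewPoly σ) : ∃ q, p * t σ = t σ * q := by
  induction p using SkewPoly.induction with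
  | h0 => exact ⟨0, by simp⟩
  | ha i a q hq =>
    obtain ⟨r, hr⟩ := hq
    refine ⟨monomial σ i (σ.symm a) + r, ?_⟩
    rw [mul_add, add_mul, hr, t, monomial_mul_monomial, monomial_mul_monomial, add_comm 1]
    simp

end SkewPoly

end Coefficients

/-! ### Membership in the code by coefficients -/

section CodeCoefficients

variable {C D : Type*} [Field C] [DivisionRing D] [Algebra C D]

/-- Positivity of `lm` separates the constant coefficient from the top one, so that `d₀` can be
recovered from the polynomial. -/
theorem mem_setA_iff {σ ρ : D ≃+* D} {ν : D} {l m : ℕ} (h : 0 < l * m) {a : SkewPoly σ} :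
    a ∈ setA C σ ρ ν l m ↔
      SkewPoly.DegLT (l * m + 1) a ∧ a.coeff (l * m) = ν * ρ (a.coeff 0) := by
  have key : ∀ (d : ℕ → D) (c : D) (j : ℕ), ((∑ i ∈ Finset.range (l * m), SkewPoly.monomial σ i (d i)) +
      SkewPoly.monomial σ (l * m) c).coeff j =
      if j < l * m then d j else if j = l * m then c else 0 := by
    intro d c j
    simp only [SkewPoly.coeff_add, SkewPoly.coeff_sum, SkewPoly.coeff_monomial,
      Finset.sum_ite_eq', Finset.mem_range]
    by_cases h1 : j < l * m
    · rw [if_pos h1, if_pos h1, if_neg (by omega), add_zero]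
    · rw [if_neg h1, if_neg h1, zero_add]
      simp [eq_comm]
  constructor
  · rintro ⟨d, rfl⟩
    refine ⟨fun i hi => ?_, ?_⟩
    · rw [key, if_neg (by omega), if_neg (by omega)]
    · rw [key, key, if_neg (by omega), if_pos rfl, if_pos h]
  · rintro ⟨h1, h2⟩
    refine ⟨a.coeff, ?_⟩
    ext j
    rw [key, ← h2]
    split_ifs with h3 h4
    · rfl
    · rw [h4]
    · exact h1 j (by omega)

theorem mem_code_iff {σ ρ : D ≃+* D} {ν : D} {l m : ℕ} {f : SkewPoly σ}
    {Φ : Module.End (fixF C σ) (Vf f)} :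
    Φ ∈ code C ρ ν l m f ↔ ∃ a ∈ setA C σ ρ ν l m, leftMul C f a = Φ := Iff.rfl

theorem coeff_smul {σ : D ≃+* D} (c : fixF C σ) (p : SkewPoly σ) (i : ℕ) :
    (c • p).coeff i = c • p.coeff i := by
  rw [Algebra.smul_def, algebraMap_skewPoly, SkewPoly.coeff_const_mul, Algebra.smul_def]

end CodeCoefficients

/-! ### Inner automorphisms and central polynomials -/

section InnerAutomorphisms

variable {D : Type*} [DivisionRing D]

theorem IsInnerAut.mul {τ τ' : D ≃+* D} (h : IsInnerAut τ) (h' : IsInnerAut τ') :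
    IsInnerAut (τ * τ') := by
  obtain ⟨v, hv, hτ⟩ := h
  obtain ⟨w, hw, hτ'⟩ := h'
  refine ⟨v * w, mul_ne_zero hv hw, fun z => ?_⟩
  rw [RingAut.mul_apply, hτ', hτ, mul_inv_rev]
  simp only [mul_assoc]

theorem IsInnerAut.inv {τ : D ≃+* D} (h : IsInnerAut τ) : IsInnerAut (τ⁻¹) := by
  obtain ⟨v, hv, hτ⟩ := h
  refine ⟨v⁻¹, inv_ne_zero hv, fun z => (RingEquiv.symm_apply_eq τ).2 ?_⟩
  rw [hτ, inv_inv]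
  simp only [mul_assoc, mul_inv_cancel_left₀ hv, mul_inv_cancel₀ hv, mul_one]

theorem IsInnerAut.pow {τ : D ≃+* D} (h : IsInnerAut τ) (k : ℕ) : IsInnerAut (τ ^ k) := by
  induction k with
  | zero => exact ⟨1, one_ne_zero, fun z => by simp⟩
  | succ k ih => rw [pow_succ]; exact ih.mul h

/-- Inner automorphisms are closed under products and inverses, so `k` may be reduced modulo `n`. -/
theorem dvd_of_isInnerAut_pow {σ : D ≃+* D} {n : ℕ} (hn : 0 < n) (hσn : IsInnerAut (σ ^ n))
    (hσ : ∀ j : ℕ, 0 < j → j < n → ¬ IsInnerAut (σ ^ j : D ≃+* D)) {k : ℕ}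
    (hk : IsInnerAut (σ ^ k)) : n ∣ k := by
  rw [Nat.dvd_iff_mod_eq_zero]
  by_contra h0
  refine hσ (k % n) (Nat.pos_of_ne_zero h0) (Nat.mod_lt _ hn) ?_
  have h : σ ^ (k % n) = σ ^ k * ((σ ^ n) ^ (k / n))⁻¹ := by
    rw [eq_mul_inv_iff_mul_eq, ← pow_mul, ← pow_add, Nat.mod_add_div]
  rw [h]
  exact hk.mul (hσn.pow _).inv

theorem pow_mul_apply_of_conj {σ : D ≃+* D} {n : ℕ} {u : D}
    (hσn : ∀ z : D, (σ ^ n : D ≃+* D) z = u * z * u⁻¹) (j : ℕ) (z : D) :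
    (σ ^ (n * j) : D ≃+* D) z = u ^ j * z * (u ^ j)⁻¹ := by
  induction j generalizing z with
  | zero => simp
  | succ j ih =>
    rw [Nat.mul_succ, pow_add, RingAut.mul_apply, hσn, ih, pow_succ, mul_inv_rev]
    simp only [mul_assoc]

end InnerAutomorphisms

section CentralElements

variable {C D : Type*} [Field C] [DivisionRing D] [Algebra C D]
  {σ : D ≃+* D} {n : ℕ} {u : D}

/-- Passing `tⁿ` over a constant conjugates it by `u`, which the factor `u⁻¹` undoes; `σ(u) = u`
lets `u⁻¹` pass `t`. -/
theorem commute_invMulPow (hu : u ≠ 0) (hσn : ∀ z : D, (σ ^ n : D ≃+* D) z = u * z * u⁻¹)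
    (hσu : σ u = u) (p : SkewPoly σ) :
    Commute (SkewPoly.const σ u⁻¹ * SkewPoly.t σ ^ n) p := by
  have hi : ∀ i : ℕ, (σ ^ i : D ≃+* D) u⁻¹ = u⁻¹ := fun i => by
    induction i with
    | zero => simp
    | succ i ih => rw [pow_succ, RingAut.mul_apply, map_inv₀, hσu, ih]
  rw [← SkewPoly.monomial_eq]
  induction p using SkewPoly.induction with
  | h0 => exact Commute.zero_right _
  | ha i a q hq =>
    refine Commute.add_right ?_ hq
    show _ * _ = _ * _
    rw [SkewPoly.monomial_mul_monomial, SkewPoly.monomial_mul_monomial, hσn, hi, add_comm]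
    simp only [mul_assoc, inv_mul_cancel_left₀ hu]

theorem commute_evalCentral (hu : u ≠ 0)
    (hσn : ∀ z : D, (σ ^ n : D ≃+* D) z = u * z * u⁻¹) (hσu : σ u = u)
    (z : (fixF C σ)[X]) (p : SkewPoly σ) : Commute (evalCentral σ u n z) p := by
  rw [evalCentral, aeval_eq_sum_range]
  exact Commute.sum_left _ _ _ fun i _ =>
    ((commute_invMulPow hu hσn hσu p).pow_left i).smul_left _

theorem invMulPow_pow (hσu : σ u = u) (j : ℕ) :
    (SkewPoly.const σ u⁻¹ * SkewPoly.t σ ^ n) ^ j =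
      SkewPoly.monomial σ (n * j) (u⁻¹ ^ j) := by
  have hi : ∀ (i : ℕ), (σ ^ i : D ≃+* D) u⁻¹ = u⁻¹ := fun i => by
    induction i with
    | zero => simp
    | succ i ih => rw [pow_succ, RingAut.mul_apply, map_inv₀, hσu, ih]
  induction j with
  | zero => simp [SkewPoly.monomial_eq]
  | succ j ih =>
    rw [pow_succ, ih, ← SkewPoly.monomial_eq, SkewPoly.monomial_mul_monomial, hi, ← pow_succ,
      Nat.mul_succ]

theorem coeff_evalCentral (hn : 0 < n) (hσu : σ u = u) (p : (fixF C σ)[X]) (i : ℕ) :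
    (evalCentral σ u n p).coeff i =
      if n ∣ i then algebraMap (fixF C σ) D (p.coeff (i / n)) * u⁻¹ ^ (i / n) else 0 := by
  rw [evalCentral, aeval_eq_sum_range, SkewPoly.coeff_sum]
  simp only [invMulPow_pow hσu, coeff_smul, SkewPoly.coeff_monomial]
  by_cases h : n ∣ i
  · obtain ⟨j, rfl⟩ := h
    rw [if_pos (dvd_mul_right n j), Nat.mul_div_cancel_left j hn, ← Algebra.smul_def]
    simp only [Nat.mul_right_inj hn.ne', smul_ite, smul_zero, Finset.sum_ite_eq',
      Finset.mem_range]
    split_ifs with hj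
    · rfl
    · rw [coeff_eq_zero_of_natDegree_lt (by omega), zero_smul]
  · rw [if_neg h]
    refine Finset.sum_eq_zero fun j _ => ?_
    rw [if_neg (fun h' => h ⟨j, h'.symm⟩), smul_zero]

theorem natDegree_mul_eq_of_degree_evalCentral (hn : 0 < n) (hu : u ≠ 0) (hσu : σ u = u)
    {p : (fixF C σ)[X]} (hp : p ≠ 0) {k : ℕ} (h : (evalCentral σ u n p).degree = k) :
    n * p.natDegree = k := by
  have h1 := SkewPoly.coeff_ne_zero_of_degree_eq h
  have h2 := SkewPoly.degLT_of_degree_eq h (n * p.natDegree)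
  rw [coeff_evalCentral hn hσu] at h1 h2
  have hk : n ∣ k := by
    by_contra hk
    exact h1 (if_neg hk)
  obtain ⟨j, rfl⟩ := hk
  rw [if_pos (dvd_mul_right _ _), Nat.mul_div_cancel_left _ hn] at h1 h2
  refine le_antisymm ?_ (Nat.mul_le_mul_left n (le_natDegree_of_ne_zero fun h0 => h1 ?_))
  · by_contra hlt
    refine mul_ne_zero ?_ (pow_ne_zero _ (inv_ne_zero hu)) (h2 (by omega))
    exact (_root_.map_ne_zero _).2 (leadingCoeff_ne_zero.2 hp)
  · rw [h0, map_zero, zero_mul]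

end CentralElements

/-! ### The action on the simple module `V_f` and its annihilator -/

section SimpleModule

/-- A normal element acts on a simple module bijectively or as zero. -/
theorem bijective_smul_of_normal {R V : Type*} [Ring R] [AddCommGroup V] [Module R V]
    [IsSimpleModule R V] {a : R} (h₁ : ∀ r, ∃ r', a * r = r' * a)
    (h₂ : ∀ r, ∃ r', r * a = a * r') (ha : ∃ v : V, a • v ≠ 0) :
    Function.Bijective fun v : V => a • v := by
  obtain ⟨v, hv⟩ := ha
  -- Normality is what makes the kernel and the image of `v ↦ a • v` into `R`-submodules.
  let K : Submodule R V :=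
    { carrier := {v | a • v = 0}
      zero_mem' := smul_zero a
      add_mem' := fun {x y} hx hy => by
        simp only [Set.mem_ofPred_eq] at *
        rw [smul_add, hx, hy, add_zero]
      smul_mem' := fun r x hx => by
        obtain ⟨r', hr'⟩ := h₁ r
        simp only [Set.mem_ofPred_eq] at *
        rw [← mul_smul, hr', mul_smul, hx, smul_zero] }
  let T : Submodule R V :=
    { carrier := Set.range fun v : V => a • v
      zero_mem' := ⟨0, smul_zero a⟩
      add_mem' := by
        rintro _ _ ⟨x, rfl⟩ ⟨y, rfl⟩
        exact ⟨x + y, smul_add a x y⟩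
      smul_mem' := by
        rintro r _ ⟨x, rfl⟩
        obtain ⟨r', hr'⟩ := h₂ r
        exact ⟨r' • x, by simp only [← mul_smul, hr']⟩ }
  have hK : K = ⊥ := (eq_bot_or_eq_top K).resolve_right fun h =>
    hv (show v ∈ K from h ▸ Submodule.mem_top)
  have hT : T = ⊤ := (eq_bot_or_eq_top T).resolve_left fun h =>
    hv ((Submodule.mem_bot R).1 (h ▸ (⟨v, rfl⟩ : a • v ∈ T)))
  refine ⟨fun x y hxy => ?_, fun y => (hT ▸ Submodule.mem_top : y ∈ T)⟩
  have hmem : x - y ∈ K := show a • (x - y) = 0 by rw [smul_sub]; exact sub_eq_zero.2 hxy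
  rw [hK] at hmem
  exact sub_eq_zero.1 ((Submodule.mem_bot R).1 hmem)

end SimpleModule

section Annihilator

variable {C D : Type*} [Field C] [DivisionRing D] [Algebra C D]
  {σ : D ≃+* D} {n : ℕ} {u : D} {f : SkewPoly σ}

theorem isSimpleModule_Vf (hf : Irreducible f) : IsSimpleModule (SkewPoly σ) (Vf f) :=
  isSimpleModule_iff_isCoatom.2 (SkewPoly.isCoatom_span_of_irreducible hf)

theorem mk_eq_zero_iff (a : SkewPoly σ) :
    (Submodule.Quotient.mk a : Vf f) = 0 ↔ ∃ g, a = g * f := by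
  rw [Submodule.Quotient.mk_eq_zero, Submodule.mem_span_singleton]
  simp only [smul_eq_mul, eq_comm]

theorem leftMul_eq_zero_iff (a : SkewPoly σ) :
    leftMul C f a = 0 ↔ ∀ b, ∃ g, a * b = g * f := by
  constructor
  · intro h b
    rw [← mk_eq_zero_iff, ← leftMul_mk (C := C), h, LinearMap.zero_apply]
  · intro h
    refine LinearMap.ext fun v => ?_
    obtain ⟨b, rfl⟩ := Submodule.Quotient.mk_surjective _ v
    rw [leftMul_mk, LinearMap.zero_apply, mk_eq_zero_iff]
    exact h b

/-- If the normal element `t` killed `V_f`, then `f` would be a right divisor of `t` as well as of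
itself, hence a unit. -/
theorem bijective_leftMul_t (hf : Irreducible f) (hft : RightCoprime f (SkewPoly.t σ)) :
    Function.Bijective (leftMul C f (SkewPoly.t σ)) := by
  have := isSimpleModule_Vf hf
  refine bijective_smul_of_normal (R := SkewPoly σ) (V := Vf f)
    SkewPoly.exists_t_mul_eq_mul_t SkewPoly.exists_mul_t_eq_t_mul
    ⟨Submodule.Quotient.mk 1, fun h => ?_⟩
  have h' : (Submodule.Quotient.mk (SkewPoly.t σ * 1) : Vf f) = 0 := h
  rw [mul_one, mk_eq_zero_iff] at h'
  exact hf.not_isUnit (hft f ⟨1, (one_mul f).symm⟩ h')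

/-- A central element kills `V_f` as soon as it kills the generator `1 + Rf`. -/
theorem leftMul_evalCentral_eq_zero_iff (hu : u ≠ 0)
    (hσn : ∀ z : D, (σ ^ n : D ≃+* D) z = u * z * u⁻¹) (hσu : σ u = u) (p : (fixF C σ)[X]) :
    leftMul C f (evalCentral σ u n p) = 0 ↔ ∃ g, evalCentral σ u n p = g * f := by
  rw [leftMul_eq_zero_iff]
  constructor
  · intro h
    simpa using h 1
  · rintro ⟨g, hg⟩ b
    exact ⟨b * g, by rw [(commute_evalCentral hu hσn hσu p b).eq, hg, mul_assoc]⟩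

/-- The remainder of `p` modulo `ĥ` kills `V_f` too; made monic, it would contradict the minimality
of `ĥ` unless it is zero. -/
theorem leftMul_evalCentral_eq_zero_iff_dvd (hu : u ≠ 0)
    (hσn : ∀ z : D, (σ ^ n : D ≃+* D) z = u * z * u⁻¹) (hσu : σ u = u)
    {hhat : (fixF C σ)[X]} (hh : IsMCLM u n f hhat) (p : (fixF C σ)[X]) :
    leftMul C f (evalCentral σ u n p) = 0 ↔ hhat ∣ p := by
  have hev : ∀ p q : (fixF C σ)[X],
      leftMul C f (evalCentral σ u n (p * q)) =
        leftMul C f (evalCentral σ u n p) * leftMul C f (evalCentral σ u n q) := fun p q => by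
    rw [evalCentral, map_mul, map_mul]; rfl
  have hh0 : leftMul C f (evalCentral σ u n hhat) = 0 :=
    (leftMul_evalCentral_eq_zero_iff hu hσn hσu _).2 hh.left_multiple
  constructor
  · intro hp
    rw [← modByMonic_eq_zero_iff_dvd hh.monic]
    set r := p %ₘ hhat with hr
    by_contra hr0
    have hLr : leftMul C f (evalCentral σ u n r) = 0 := by
      have hpr : evalCentral σ u n p = evalCentral σ u n r + evalCentral σ u n (hhat * (p /ₘ hhat)) := by
        conv_lhs => rw [← modByMonic_add_div p hhat]
        rw [evalCentral, map_add]; rfl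
      have := congrArg (leftMul C f) hpr
      rw [map_add, hev, hh0, zero_mul, add_zero, hp] at this
      exact this.symm
    have hle := hh.minimal (r * Polynomial.C r.leadingCoeff⁻¹) (monic_mul_leadingCoeff_inv hr0)
      ((leftMul_evalCentral_eq_zero_iff hu hσn hσu _).1 (by rw [hev, hLr, zero_mul]))
    rw [natDegree_mul_leadingCoeff_inv _ hr0] at hle
    have := degree_modByMonic_lt p hh.monic
    exact absurd (natDegree_lt_natDegree hr0 this) (not_lt.2 hle)
  · rintro ⟨q, rfl⟩
    rw [hev, hh0, zero_mul]

/-- Central elements act on a simple module bijectively or as zero, so the kernel of the action of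
`F[x]`, generated by `ĥ`, is prime. -/
theorem irreducible_of_isMCLM (hu : u ≠ 0)
    (hσn : ∀ z : D, (σ ^ n : D ≃+* D) z = u * z * u⁻¹) (hσu : σ u = u) (hf : Irreducible f)
    {hhat : (fixF C σ)[X]} (hh : IsMCLM u n f hhat) : Irreducible hhat := by
  have := isSimpleModule_Vf hf
  have : Nontrivial (Vf f) := IsSimpleModule.nontrivial (SkewPoly σ) (Vf f)
  have hdvd := leftMul_evalCentral_eq_zero_iff_dvd hu hσn hσu hh
  refine Prime.irreducible ⟨hh.monic.ne_zero, fun h => ?_, fun p q hpq => ?_⟩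
  · have h1 := (hdvd 1).2 h.dvd
    rw [evalCentral, map_one, map_one] at h1
    exact one_ne_zero h1
  · rw [← hdvd, ← hdvd]
    by_contra! hne
    obtain ⟨v, hv⟩ := DFunLike.ne_iff.1 hne.1
    obtain ⟨w, hw⟩ := DFunLike.ne_iff.1 hne.2
    have hbij := bijective_smul_of_normal (R := SkewPoly σ) (V := Vf f)
      (fun r => ⟨r, (commute_evalCentral hu hσn hσu p r).eq⟩)
      (fun r => ⟨r, (commute_evalCentral hu hσn hσu p r).eq.symm⟩) ⟨v, hv⟩
    have h0 := (hdvd (p * q)).2 hpq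
    rw [evalCentral, map_mul, map_mul] at h0
    have h1 := LinearMap.congr_fun h0 w
    exact hw (hbij.1 (h1.trans (smul_zero _).symm))

/-- Nonzero elements of the annihilator of `V_f` of least degree come from `F[u⁻¹tⁿ]`. -/
theorem exists_evalCentral_of_leftMul_eq_zero [Algebra.IsCentral C D] (hn : 0 < n) (hu : u ≠ 0)
    (hσn : ∀ z : D, (σ ^ n : D ≃+* D) z = u * z * u⁻¹) (hσu : σ u = u)
    (hσ : ∀ j : ℕ, 0 < j → j < n → ¬ IsInnerAut (σ ^ j : D ≃+* D))
    (ht : Function.Surjective (leftMul C f (SkewPoly.t σ)))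
    {k : ℕ} {a : SkewPoly σ} (ha : leftMul C f a = 0) (ha0 : a ≠ 0) (hk : SkewPoly.DegLT k a) :
    ∃ p : (fixF C σ)[X], p ≠ 0 ∧ n * p.natDegree < k ∧
      leftMul C f (evalCentral σ u n p) = 0 := by
  classical
  have hex : ∃ k, ∃ a : SkewPoly σ, leftMul C f a = 0 ∧ a ≠ 0 ∧ SkewPoly.DegLT k a :=
    ⟨k, a, ha, ha0, hk⟩
  have hle : Nat.find hex ≤ k := Nat.find_min' hex ⟨a, ha, ha0, hk⟩
  obtain ⟨b, hb, hb0, hbdeg⟩ := Nat.find_spec hex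
  have hmin : ∀ r : SkewPoly σ, leftMul C f r = 0 → ∀ k < Nat.find hex, SkewPoly.DegLT k r → r = 0 :=
    fun r hr k hk hrk => by
      by_contra hne
      exact Nat.find_min hex hk ⟨r, hr, hne, hrk⟩
  obtain ⟨K, hK⟩ : ∃ K, Nat.find hex = K + 1 := Nat.exists_eq_succ_of_ne_zero fun h0 => hb0 <| by
    rw [h0] at hbdeg
    ext i
    simpa using hbdeg i (Nat.zero_le _)
  rw [hK] at hbdeg hmin hle
  replace hmin : ∀ r : SkewPoly σ, leftMul C f r = 0 → SkewPoly.DegLT K r → r = 0 :=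
    fun r hr => hmin r hr K (Nat.lt_succ_self K)
  have hbK : b.coeff K ≠ 0 := fun h0 => hb0 <| hmin b hb fun i hi => by
    rcases hi.eq_or_lt with rfl | hi
    · exact h0
    · exact hbdeg i hi
  -- Without a constant term, `r = st`; surjectivity of `L_t` makes `s` an annihilator too, of
  -- degree below the minimal degree `K`.
  have hdiv : ∀ r : SkewPoly σ, leftMul C f r = 0 → SkewPoly.DegLT (K + 1) r →
      r.coeff 0 = 0 → r = 0 := fun r hr hrdeg hr0 => by
    obtain ⟨s, hs, rfl⟩ := SkewPoly.eq_mul_t_of_coeff_zero hrdeg hr0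
    rw [hmin s _ hs, zero_mul]
    rw [map_mul] at hr
    refine LinearMap.ext fun v => ?_
    obtain ⟨w, rfl⟩ := ht v
    exact LinearMap.congr_fun hr w
  -- the monic multiple
  set c : SkewPoly σ := SkewPoly.const σ (b.coeff K)⁻¹ * b with hc
  have hcK : c.coeff K = 1 := by rw [hc, SkewPoly.coeff_const_mul, inv_mul_cancel₀ hbK]
  have hLc : leftMul C f c = 0 := by rw [hc, map_mul, hb, mul_zero]
  have hcdeg : SkewPoly.DegLT (K + 1) c := fun i hi => by
    rw [hc, SkewPoly.coeff_const_mul, hbdeg i hi, mul_zero]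
  have hc0 : c.coeff 0 ≠ 0 := fun h0 => one_ne_zero (α := D) <| by
    rw [← hcK, hdiv c hLc hcdeg h0, SkewPoly.coeff_zero]
  clear_value c
  -- `cz - σ^K(z)c` annihilates `V_f` and has lost its leading term, so it vanishes.
  have hconj : ∀ (z : D) (i : ℕ),
      c.coeff i * (σ ^ i : D ≃+* D) z = (σ ^ K : D ≃+* D) z * c.coeff i := fun z i => by
    have h0 := hmin (c * SkewPoly.const σ z - SkewPoly.const σ ((σ ^ K : D ≃+* D) z) * c)
      (by rw [map_sub, map_mul, map_mul, hLc, zero_mul, mul_zero, sub_zero]) fun j hj => by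
        rw [SkewPoly.coeff_sub, SkewPoly.coeff_mul_const, SkewPoly.coeff_const_mul]
        rcases hj.eq_or_lt with rfl | hj
        · rw [hcK, one_mul, mul_one, sub_self]
        · rw [hcdeg j hj, zero_mul, mul_zero, sub_zero]
    rw [← SkewPoly.coeff_mul_const, ← SkewPoly.coeff_const_mul, sub_eq_zero.1 h0]
  -- `tc - ct` loses its leading term because `c` is monic, and it has no constant term, so `hdiv`
  -- applies.
  have hfix : ∀ i, σ (c.coeff i) = c.coeff i := fun i => by
    have hcoeff : ∀ j, (SkewPoly.t σ * c - c * SkewPoly.t σ).coeff j =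
        if 1 ≤ j then σ (c.coeff (j - 1)) - c.coeff (j - 1) else 0 := fun j => by
      rw [SkewPoly.coeff_sub, ← pow_one (SkewPoly.t σ), SkewPoly.coeff_t_pow_mul,
        SkewPoly.coeff_mul_t_pow]
      split_ifs <;> simp
    have h0 := hdiv (SkewPoly.t σ * c - c * SkewPoly.t σ)
      (by rw [map_sub, map_mul, map_mul, hLc, zero_mul, mul_zero, sub_zero]) (fun j hj => by
        rw [hcoeff, if_pos (by omega)]
        rcases (show K ≤ j - 1 by omega).eq_or_lt with h | h
        · rw [← h, hcK, map_one, sub_self]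
        · rw [hcdeg _ h, map_zero, sub_self]) (by rw [hcoeff, if_neg (by omega)])
    have h1 := hcoeff (i + 1)
    rw [h0, SkewPoly.coeff_zero, if_pos (by omega), Nat.add_sub_cancel] at h1
    exact sub_eq_zero.1 h1.symm
  have hconj0 : ∀ z, (σ ^ K : D ≃+* D) z = c.coeff 0 * z * (c.coeff 0)⁻¹ := fun z => by
    rw [eq_mul_inv_iff_mul_eq₀ hc0, ← hconj z 0]; simp
  -- Comparing the conjugation rule at `i` with the one at 0 shows that `σ^i` is conjugation by
  -- `c_i⁻¹c_0`.
  have hndvd : ∀ i, c.coeff i ≠ 0 → n ∣ i := fun i hi => by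
    refine dvd_of_isInnerAut_pow hn ⟨u, hu, hσn⟩ hσ
      ⟨(c.coeff i)⁻¹ * c.coeff 0, mul_ne_zero (inv_ne_zero hi) hc0, fun z => ?_⟩
    have h := hconj z i
    rw [hconj0] at h
    rw [mul_inv_rev, inv_inv, mul_assoc, mul_assoc, eq_inv_mul_iff_mul_eq₀ hi, h]
    simp only [mul_assoc]
  have hpow : ∀ j, u ^ j ≠ 0 := fun j => pow_ne_zero j hu
  -- The powers of `u` undo the inner automorphism `σ^{nj}`, so these elements are central; they are
  -- fixed by `σ` since their factors are. They are the coefficients of the required polynomial in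
  -- `u⁻¹tⁿ`.
  have hcoef : ∀ j, ∃ e : fixF C σ,
      algebraMap (fixF C σ) D e = (c.coeff 0)⁻¹ * c.coeff (n * j) * u ^ j := fun j => by
    have hcent : (c.coeff 0)⁻¹ * c.coeff (n * j) * u ^ j ∈ Subalgebra.center C D := by
      rw [Subalgebra.mem_center_iff]
      intro z
      have h := hconj z (n * j)
      rw [hconj0, pow_mul_apply_of_conj hσn] at h
      have h' : c.coeff (n * j) * u ^ j * z =
          c.coeff 0 * z * (c.coeff 0)⁻¹ * c.coeff (n * j) * u ^ j := by
        rw [← h]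
        simp only [mul_assoc, inv_mul_cancel₀ (hpow j), mul_one]
      rw [mul_assoc ((c.coeff 0)⁻¹), mul_assoc ((c.coeff 0)⁻¹), h']
      simp only [mul_assoc, inv_mul_cancel_left₀ hc0]
    rw [Algebra.IsCentral.center_eq_bot, Algebra.mem_bot] at hcent
    obtain ⟨e, he⟩ := hcent
    refine ⟨⟨e, ?_⟩, he⟩
    show σ (algebraMap C D e) = algebraMap C D e
    rw [he, map_mul, map_mul, map_inv₀, map_pow, hσu, hfix, hfix]
  choose e he using hcoef
  set p : (fixF C σ)[X] := ∑ j ∈ Finset.range (K + 1), monomial j (e j) with hp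
  have hpcoeff : ∀ j, p.coeff j = e j := fun j => by
    rw [hp, finsetSum_coeff]
    simp only [Polynomial.coeff_monomial, Finset.sum_ite_eq', Finset.mem_range]
    split_ifs with hj
    · rfl
    · have hlt : K + 1 ≤ n * j := (not_lt.1 hj).trans (Nat.le_mul_of_pos_left j hn)
      refine ((_root_.map_eq_zero (algebraMap (fixF C σ) D)).1 ?_).symm
      rw [he, hcdeg _ hlt, mul_zero, zero_mul]
  have hp0 : p ≠ 0 := fun h0 => by
    have h1 := he 0
    rw [← hpcoeff, h0, Polynomial.coeff_zero, map_zero, mul_zero, pow_zero, mul_one,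
      inv_mul_cancel₀ hc0] at h1
    exact zero_ne_one h1
  refine ⟨p, hp0, lt_of_lt_of_le (not_le.1 fun hlt => ?_) hle, ?_⟩
  · refine leadingCoeff_ne_zero.2 hp0 ((_root_.map_eq_zero (algebraMap (fixF C σ) D)).1 ?_)
    rw [leadingCoeff, hpcoeff, he, hcdeg _ hlt, mul_zero, zero_mul]
  · have hpc : evalCentral σ u n p = SkewPoly.const σ (c.coeff 0)⁻¹ * c := by
      ext i
      rw [coeff_evalCentral hn hσu, SkewPoly.coeff_const_mul]
      split_ifs with hi
      · obtain ⟨j, rfl⟩ := hi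
        rw [Nat.mul_div_cancel_left j hn, hpcoeff, he, inv_pow, mul_assoc,
          mul_inv_cancel₀ (hpow j), mul_one]
      · rw [not_imp_comm.1 (hndvd i) hi, mul_zero]
    rw [hpc, map_mul, hLc, mul_zero]

/-- The map `a ↦ L_a` is injective in degrees below that of the minimal central left multiple. -/
theorem eq_zero_of_leftMul_eq_zero [Algebra.IsCentral C D] (hn : 0 < n) (hu : u ≠ 0)
    (hσn : ∀ z : D, (σ ^ n : D ≃+* D) z = u * z * u⁻¹) (hσu : σ u = u)
    (hσ : ∀ j : ℕ, 0 < j → j < n → ¬ IsInnerAut (σ ^ j : D ≃+* D))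
    (ht : Function.Surjective (leftMul C f (SkewPoly.t σ)))
    {hhat : (fixF C σ)[X]} (hh : IsMCLM u n f hhat)
    {a : SkewPoly σ} (ha : leftMul C f a = 0) (hk : SkewPoly.DegLT (n * hhat.natDegree) a) :
    a = 0 := by
  by_contra ha0
  obtain ⟨p, hp0, hpdeg, hp⟩ :=
    exists_evalCentral_of_leftMul_eq_zero hn hu hσn hσu hσ ht ha ha0 hk
  have hdvd := (leftMul_evalCentral_eq_zero_iff_dvd hu hσn hσu hh p).1 hp
  exact absurd (Nat.mul_le_mul_left n (natDegree_le_of_dvd hdvd hp0)) (not_le.2 hpdeg)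

end Annihilator

/-! ### The degree of the centre over `F` -/

section FixedField

variable {C D : Type*} [Field C] [DivisionRing D] [Algebra C D]

theorem exists_algebraMap_eq_apply [Algebra.IsCentral C D] (τ : D ≃+* D) (c : C) :
    ∃ c', algebraMap C D c' = τ (algebraMap C D c) := by
  have h : τ (algebraMap C D c) ∈ Subalgebra.center C D := by
    rw [Subalgebra.mem_center_iff]
    intro z
    obtain ⟨w, rfl⟩ := τ.surjective z
    rw [← map_mul, ← map_mul, Algebra.commutes]
  rwa [Algebra.IsCentral.center_eq_bot, Algebra.mem_bot] at h

variable (C) in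
/-- An automorphism of `D` restricts to the centre. -/
theorem exists_restrict_center [Algebra.IsCentral C D] (σ : D ≃+* D) :
    ∃ τ : C ≃+* C, ∀ c, algebraMap C D (τ c) = σ (algebraMap C D c) := by
  choose s hs using exists_algebraMap_eq_apply (C := C) σ
  choose s' hs' using exists_algebraMap_eq_apply (C := C) σ.symm
  have hinj : Function.Injective (algebraMap C D) := (algebraMap C D).injective
  exact ⟨{ toFun := s
           invFun := s'
           left_inv := fun c => hinj (by rw [hs', hs, RingEquiv.symm_apply_apply])
           right_inv := fun c => hinj (by rw [hs, hs', RingEquiv.apply_symm_apply])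
           map_mul' := fun a b => hinj (by simp only [hs, map_mul])
           map_add' := fun a b => hinj (by simp only [hs, map_add]) }, hs⟩

/-- Conjugation by `u` is trivial on the centre, so `σ` restricts to `C` with order dividing `n`,
and `F` is the fixed field of the cyclic group it generates. -/
theorem finite_and_finrank_fixF_le [Algebra.IsCentral C D] {σ : D ≃+* D} {n : ℕ} (hn : 0 < n)
    {u : D} (hu : u ≠ 0) (hσn : ∀ z : D, (σ ^ n : D ≃+* D) z = u * z * u⁻¹) :
    FiniteDimensional (fixF C σ) C ∧ Module.finrank (fixF C σ) C ≤ n := by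
  obtain ⟨τ, hτ⟩ := exists_restrict_center C σ
  have hinj : Function.Injective (algebraMap C D) := (algebraMap C D).injective
  have hpow : ∀ (k : ℕ) (c : C),
      algebraMap C D ((τ ^ k : RingAut C) c) = (σ ^ k : D ≃+* D) (algebraMap C D c) := fun k => by
    induction k with
    | zero => intro c; rfl
    | succ k ih => intro c; rw [pow_succ, pow_succ, RingAut.mul_apply, RingAut.mul_apply, ih, hτ]
  have hτn : (τ ^ n : RingAut C) = 1 := RingEquiv.ext fun c => hinj <| by
    rw [hpow, hσn, ← Algebra.commutes, mul_assoc, mul_inv_cancel₀ hu, mul_one]; rfl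
  let G := Subgroup.zpowers (τ : RingAut C)
  have hfin : Finite G := finite_zpowers.2 (isOfFinOrder_iff_pow_eq_one.2 ⟨n, hn, hτn⟩)
  let _ : Fintype G := Fintype.ofFinite G
  have hcard : Fintype.card G ≤ n := by
    rw [← Nat.card_eq_fintype_card, Nat.card_zpowers]
    exact Nat.le_of_dvd hn (orderOf_dvd_of_pow_eq_one hτn)
  have heq : FixedPoints.subfield G C = fixF C σ := by
    ext c
    constructor
    · intro h
      have h1 : τ c = c := h ⟨τ, Subgroup.mem_zpowers _⟩
      show σ (algebraMap C D c) = algebraMap C D c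
      rw [← hτ, h1]
    · intro h
      have h1 : τ c = c := hinj ((hτ c).trans h)
      rintro ⟨g, hg⟩
      have hle : Subgroup.zpowers (τ : RingAut C) ≤ MulAction.stabilizer (RingAut C) c :=
        (Subgroup.zpowers_le (G := RingAut C)).2 h1
      exact hle hg
  rw [← heq]
  exact ⟨inferInstance, (FixedPoints.finrank_le_card G C).trans hcard⟩

end FixedField

/-! ### Double centralizers by dimension count -/

section DoubleCentralizer

/-- Double centralizer by dimension count: a `K`-space of `E`-linear maps of `V` that is as large
as `End_E(V)` has only the scalars of `E` as its `E`-linear centralizer. -/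
theorem exists_eq_smul_of_commute {K E V N : Type*} [Field K] [Field E] [Algebra K E]
    [FiniteDimensional K E] [AddCommGroup V] [Module K V] [Module E V] [IsScalarTower K E V]
    [FiniteDimensional K V] [AddCommGroup N] [Module K N]
    (φ : N →ₗ[K] Module.End K V) (hφ : Function.Injective φ)
    (hφE : ∀ (x : N) (e : E) (v : V), φ x (e • v) = e • φ x v)
    (hdim : Module.finrank K V ^ 2 ≤ Module.finrank K N * Module.finrank K E)
    (Φ : Module.End K V) (hΦE : ∀ (e : E) (v : V), Φ (e • v) = e • Φ v)
    (hΦ : ∀ x, Φ * φ x = φ x * Φ) : ∃ e : E, ∀ v, Φ v = e • v := by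
  have : FiniteDimensional E V := FiniteDimensional.right K E V
  let φE : N →ₗ[K] Module.End E V :=
    { toFun := fun x =>
        { toFun := φ x
          map_add' := map_add (φ x)
          map_smul' := hφE x }
      map_add' := fun x y => LinearMap.ext fun v => by simp
      map_smul' := fun c x => LinearMap.ext fun v => by simp }
  have hφE_inj : Function.Injective φE := fun x y hxy =>
    hφ (LinearMap.ext fun v => LinearMap.congr_fun hxy v)
  have : FiniteDimensional K (Module.End E V) :=
    FiniteDimensional.trans K E (Module.End E V)
  have : FiniteDimensional K N := Module.Finite.of_injective φE hφE_inj
  have h1 := Module.finrank_mul_finrank K E V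
  have h2 := Module.finrank_mul_finrank K E (Module.End E V)
  rw [Module.finrank_linearMap] at h2
  have hpos : 0 < Module.finrank K E := Module.finrank_pos
  -- Since `dim_K End_E(V) · [E:K] = (dim_K V)²`, this is the assumed inequality divided by `[E:K]`.
  have hle : Module.finrank K (Module.End E V) ≤ Module.finrank K N := by
    refine Nat.le_of_mul_le_mul_right (le_trans (le_of_eq ?_) hdim) hpos
    rw [← h2, ← h1]
    ring
  have heq := le_antisymm (LinearMap.finrank_le_finrank_of_injective hφE_inj) hle
  have hsurj := (LinearMap.injective_iff_surjective_of_finrank_eq_finrank heq).1 hφE_inj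
  let ΦE : Module.End E V :=
    { toFun := Φ
      map_add' := map_add Φ
      map_smul' := hΦE }
  have hcent : ΦE ∈ Subalgebra.center E (Module.End E V) := by
    rw [Subalgebra.mem_center_iff]
    intro Ψ
    obtain ⟨x, rfl⟩ := hsurj Ψ
    exact LinearMap.ext fun v => (LinearMap.congr_fun (hΦ x) v).symm
  obtain ⟨e, _, he⟩ := Module.End.mem_subalgebraCenter_iff.1 hcent
  exact ⟨e, fun v => LinearMap.congr_fun he v⟩

end DoubleCentralizer

section Dimension

variable {C D : Type*} [Field C] [DivisionRing D] [Algebra C D] {σ : D ≃+* D} {n : ℕ} {u : D}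
  {f : SkewPoly σ}

variable (C σ) in
/-- The skew polynomials of degree less than `k`, parametrised by their coefficients. -/
def ofCoeffs (k : ℕ) : (Fin k → D) →ₗ[fixF C σ] SkewPoly σ where
  toFun a := ∑ i : Fin k, SkewPoly.monomial σ i (a i)
  map_add' a b := by simp [Finset.sum_add_distrib]
  map_smul' c a := by simp [Finset.smul_sum, smul_monomial]

theorem coeff_ofCoeffs (k : ℕ) (a : Fin k → D) (j : ℕ) :
    (ofCoeffs C σ k a).coeff j = if h : j < k then a ⟨j, h⟩ else 0 := by
  show (∑ i : Fin k, SkewPoly.monomial σ i (a i)).coeff j = _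
  simp only [SkewPoly.coeff_sum, SkewPoly.coeff_monomial]
  split_ifs with h
  · rw [Finset.sum_eq_single ⟨j, h⟩ (fun i _ hi => if_neg fun hij => hi (Fin.ext hij)) (by simp),
      if_pos rfl]
  · exact Finset.sum_eq_zero fun i _ => if_neg (by omega)

theorem degLT_ofCoeffs (k : ℕ) (a : Fin k → D) : SkewPoly.DegLT k (ofCoeffs C σ k a) :=
  fun j hj => by rw [coeff_ofCoeffs, dif_neg (by omega)]

theorem ofCoeffs_eq_zero {k : ℕ} {a : Fin k → D} (h : ofCoeffs C σ k a = 0) : a = 0 := by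
  funext i
  have h1 := coeff_ofCoeffs (C := C) (σ := σ) k a i
  rw [h, dif_pos i.2] at h1
  exact h1.symm

theorem exists_ofCoeffs_eq {k : ℕ} {p : SkewPoly σ} (h : SkewPoly.DegLT k p) :
    ∃ a : Fin k → D, ofCoeffs C σ k a = p := by
  refine ⟨fun i => p.coeff i, ?_⟩
  ext j
  rw [coeff_ofCoeffs]
  split_ifs with hj
  · rfl
  · exact (h j (by omega)).symm

/-- The remainders of right division by `f` represent every class. -/
theorem finite_and_finrank_Vf_le [FiniteDimensional (fixF C σ) D] {m : ℕ}
    (hf : SkewPoly.DegLT (m + 1) f) (hfm : f.coeff m ≠ 0) :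
    FiniteDimensional (fixF C σ) (Vf f) ∧
      Module.finrank (fixF C σ) (Vf f) ≤ m * Module.finrank (fixF C σ) D := by
  let π : SkewPoly σ →ₗ[fixF C σ] Vf f :=
    (Submodule.mkQ (Submodule.span (SkewPoly σ) {f})).restrictScalars (fixF C σ)
  have hsurj : Function.Surjective (π ∘ₗ ofCoeffs C σ m) := fun v => by
    obtain ⟨p, rfl⟩ := Submodule.Quotient.mk_surjective _ v
    obtain ⟨q, r, hqr, hr⟩ := SkewPoly.exists_eq_mul_add hf hfm p
    obtain ⟨a, ha⟩ := exists_ofCoeffs_eq (C := C) hr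
    refine ⟨a, ?_⟩
    rw [LinearMap.comp_apply, ha]
    refine ((Submodule.Quotient.eq _).2 (Submodule.mem_span_singleton.2 ⟨q, ?_⟩)).symm
    rw [hqr, smul_eq_mul, add_sub_cancel_right]
  refine ⟨Module.Finite.of_surjective _ hsurj, ?_⟩
  have h := LinearMap.finrank_le_finrank_of_surjective hsurj
  rwa [Module.finrank_pi_fintype, Finset.sum_const, Finset.card_univ, Fintype.card_fin,
    smul_eq_mul] at h

end Dimension

/-! ### The centralizer of the action of `R` -/

section Centralizer

variable {C D : Type*} [Field C] [DivisionRing D] [Algebra C D] {σ : D ≃+* D} {n : ℕ} {u : D}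
  {f : SkewPoly σ}

variable (C) in
/-- The action of `F[x]` on `V_f` in which `x` acts as `u⁻¹tⁿ`. -/
def evalEnd (u : D) (n : ℕ) (f : SkewPoly σ) :
    (fixF C σ)[X] →ₐ[fixF C σ] Module.End (fixF C σ) (Vf f) :=
  (leftMul C f).comp (aeval (SkewPoly.const σ u⁻¹ * SkewPoly.t σ ^ n))

/-- The action of `E_ĥ = F[x]/(ĥ)` on `V_f`. -/
def adjoinRootEnd (u : D) (n : ℕ) (f : SkewPoly σ) (hhat : (fixF C σ)[X])
    (h : evalEnd C u n f hhat = 0) :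
    AdjoinRoot hhat →ₐ[fixF C σ] Module.End (fixF C σ) (Vf f) :=
  Ideal.Quotient.liftₐ (Ideal.span {hhat}) (evalEnd C u n f) fun p hp => by
    obtain ⟨q, rfl⟩ := Ideal.mem_span_singleton.1 hp
    rw [map_mul, h, zero_mul]

theorem adjoinRootEnd_mk {hhat : (fixF C σ)[X]} (h : evalEnd C u n f hhat = 0)
    (p : (fixF C σ)[X]) :
    adjoinRootEnd u n f hhat h (AdjoinRoot.mk hhat p) = leftMul C f (evalCentral σ u n p) := rfl

/-- The centralizer of the action of `R` on `V_f` is `E_ĥ`. -/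
theorem exists_adjoinRootEnd_eq_of_commute [Algebra.IsCentral C D] [FiniteDimensional C D]
    {d : ℕ} (hd : Module.finrank C D = d ^ 2) (hn : 0 < n) (hu : u ≠ 0)
    (hσn : ∀ z : D, (σ ^ n : D ≃+* D) z = u * z * u⁻¹) (hσu : σ u = u)
    (hσ : ∀ j : ℕ, 0 < j → j < n → ¬ IsInnerAut (σ ^ j : D ≃+* D))
    (hf : Irreducible f) (ht : Function.Surjective (leftMul C f (SkewPoly.t σ)))
    {m : ℕ} (hfdeg : SkewPoly.DegLT (m + 1) f) (hfm : f.coeff m ≠ 0)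
    {hhat : (fixF C σ)[X]} (hh : IsMCLM u n f hhat) (hdeg : hhat.natDegree = d * m)
    (h0 : evalEnd C u n f hhat = 0)
    {Φ : Module.End (fixF C σ) (Vf f)} (hΦ : ∀ a, Φ * leftMul C f a = leftMul C f a * Φ) :
    ∃ e, adjoinRootEnd u n f hhat h0 e = Φ := by
  have : Fact (Irreducible hhat) := ⟨irreducible_of_isMCLM hu hσn hσu hf hh⟩
  obtain ⟨hCfin, hCle⟩ := finite_and_finrank_fixF_le (C := C) hn hu hσn
  have hDfin : FiniteDimensional (fixF C σ) D := FiniteDimensional.trans (fixF C σ) C D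
  have hDrank : Module.finrank (fixF C σ) D = Module.finrank (fixF C σ) C * d ^ 2 := by
    rw [← hd, Module.finrank_mul_finrank]
  obtain ⟨hVfin, hVle⟩ := finite_and_finrank_Vf_le (C := C) hfdeg hfm
  have hEfin : FiniteDimensional (fixF C σ) (AdjoinRoot hhat) :=
    (AdjoinRoot.powerBasis hh.monic.ne_zero).finite
  have hErank : Module.finrank (fixF C σ) (AdjoinRoot hhat) = d * m := by
    rw [← hdeg]; exact finrank_quotient_span_eq_natDegree
  let ψ := adjoinRootEnd u n f hhat h0
  let _ : Module (AdjoinRoot hhat) (Vf f) := Module.compHom (Vf f) ψ.toRingHom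
  have hsmul : ∀ (e : AdjoinRoot hhat) (v : Vf f), e • v = ψ e v := fun e v => rfl
  have : IsScalarTower (fixF C σ) (AdjoinRoot hhat) (Vf f) :=
    ⟨fun c e v => by rw [hsmul, hsmul, map_smul, LinearMap.smul_apply]⟩
  have hψ : ∀ (a : SkewPoly σ) (e : AdjoinRoot hhat),
      leftMul C f a * ψ e = ψ e * leftMul C f a := fun a e => by
    induction e using AdjoinRoot.induction_on with
    | _ p =>
      rw [adjoinRootEnd_mk, ← map_mul, ← map_mul, (commute_evalCentral hu hσn hσu p a).eq]
  -- The large space of `E_ĥ`-linear maps consists of the `L_a` with `deg a < dmn`, the range in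
  -- which `a ↦ L_a` is injective.
  obtain ⟨e, he⟩ := exists_eq_smul_of_commute (E := AdjoinRoot hhat)
    ((leftMul C f).toLinearMap ∘ₗ ofCoeffs C σ (n * (d * m)))
    ((injective_iff_map_eq_zero _).2 fun a ha => ofCoeffs_eq_zero (C := C) (σ := σ) <|
      eq_zero_of_leftMul_eq_zero hn hu hσn hσu hσ ht hh ha
        (by rw [hdeg]; exact degLT_ofCoeffs (C := C) _ a))
    (fun a e v => LinearMap.congr_fun (hψ _ e) v)
    (by
      rw [Module.finrank_pi_fintype, Finset.sum_const, Finset.card_univ, Fintype.card_fin,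
        smul_eq_mul, hErank]
      -- With `[D:F] = [C:F]d²`, the count reduces to replacing one factor `[C:F]` by `n`.
      rw [hDrank] at hVle ⊢
      calc _ ≤ (m * (Module.finrank (fixF C σ) C * d ^ 2)) ^ 2 := Nat.pow_le_pow_left hVle 2
        _ = Module.finrank (fixF C σ) C * (Module.finrank (fixF C σ) C * (d ^ 4 * m ^ 2)) := by ring
        _ ≤ n * (Module.finrank (fixF C σ) C * (d ^ 4 * m ^ 2)) := Nat.mul_le_mul_right _ hCle
        _ = _ := by ring)
    Φ
    (fun e v => by
      have hc : Φ * ψ e = ψ e * Φ := by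
        induction e using AdjoinRoot.induction_on with
        | _ p => exact hΦ _
      exact LinearMap.congr_fun hc v)
    (fun a => hΦ _)
  exact ⟨e, LinearMap.ext fun v => (he v).symm⟩

end Centralizer

/-! ### Operators that preserve or centralise the code -/

section CodeIdealisers

variable {C D : Type*} [Field C] [DivisionRing D] [Algebra C D] {σ ρ : D ≃+* D} {ν : D}
  {n : ℕ} {u : D} {l m B : ℕ} {f : SkewPoly σ}

theorem leftMul_mem_endEf (hu : u ≠ 0) (hσn : ∀ z : D, (σ ^ n : D ≃+* D) z = u * z * u⁻¹)
    (hσu : σ u = u) (a : SkewPoly σ) : leftMul C f a ∈ endEf C u n f := by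
  rw [endEf, Subalgebra.mem_centralizer_iff]
  rintro _ ⟨z, rfl⟩
  rw [← map_mul, ← map_mul, (commute_evalCentral hu hσn hσu z a).eq]

/-- Turns identities between operators into identities between polynomials; `B` stands for `deg h`.
-/
theorem eq_of_leftMul_eq (hinj : ∀ a, leftMul C f a = 0 → SkewPoly.DegLT B a → a = 0)
    {a b : SkewPoly σ} (hab : leftMul C f a = leftMul C f b) {k j : ℕ}
    (ha : SkewPoly.DegLT k a) (hb : SkewPoly.DegLT j b) (hk : k ≤ B) (hj : j ≤ B) : a = b :=
  sub_eq_zero.1 <| hinj (a - b) (by rw [map_sub, hab, sub_self]) ((ha.mono hk).sub (hb.mono hj))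

theorem degLT_t_pow (i : ℕ) : SkewPoly.DegLT (i + 1) (SkewPoly.t σ ^ i) := fun j hj => by
  rw [SkewPoly.coeff_t_pow, if_neg (by omega)]

theorem t_pow_mem_setA {i : ℕ} (h0 : 0 < i) (hi : i < l * m) :
    SkewPoly.t σ ^ i ∈ setA C σ ρ ν l m := by
  rw [mem_setA_iff (by omega)]
  refine ⟨(degLT_t_pow i).mono (by omega), ?_⟩
  rw [SkewPoly.coeff_t_pow, SkewPoly.coeff_t_pow, if_neg (by omega), if_neg (by omega), map_zero,
    mul_zero]

theorem degLT_mul_t_pow {p : SkewPoly σ} {k : ℕ} (h : SkewPoly.DegLT k p) (i : ℕ) :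
    SkewPoly.DegLT (k + i) (p * SkewPoly.t σ ^ i) := fun j hj => by
  rw [SkewPoly.coeff_mul_t_pow, if_pos (by omega), h _ (by omega)]

theorem degLT_t_pow_mul {p : SkewPoly σ} {k : ℕ} (h : SkewPoly.DegLT k p) (i : ℕ) :
    SkewPoly.DegLT (k + i) (SkewPoly.t σ ^ i * p) := fun j hj => by
  rw [SkewPoly.coeff_t_pow_mul, if_pos (by omega), h _ (by omega), map_zero]

/-- The element `1 + ν t^{lm}` of `A`. -/
theorem one_add_mem_setA (h : 0 < l * m) :
    SkewPoly.const σ 1 + SkewPoly.monomial σ (l * m) ν ∈ setA C σ ρ ν l m := by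
  rw [mem_setA_iff h]
  refine ⟨fun i hi => ?_, ?_⟩ <;>
    simp only [SkewPoly.coeff_add, SkewPoly.coeff_const, SkewPoly.coeff_monomial]
  · rw [if_neg (by omega), if_neg (by omega), add_zero]
  · rw [if_neg h.ne', if_neg h.ne']
    simp

theorem exists_const_of_mul_mem_code (hlm : 2 < l * m) (hB : 2 * (l * m) ≤ B)
    (ht : Function.Surjective (leftMul C f (SkewPoly.t σ)))
    (hinj : ∀ a, leftMul C f a = 0 → SkewPoly.DegLT B a → a = 0)
    {Φ : Module.End (fixF C σ) (Vf f)}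
    (hΦ : ∀ M ∈ code C ρ ν l m f, Φ * M ∈ code C ρ ν l m f) :
    ∃ c, leftMul C f (SkewPoly.const σ c) = Φ ∧ c * ν = ν * ρ c := by
  have hΦA : ∀ a ∈ setA C σ ρ ν l m, ∃ b, (SkewPoly.DegLT (l * m + 1) b ∧
      b.coeff (l * m) = ν * ρ (b.coeff 0)) ∧ leftMul C f b = Φ * leftMul C f a := fun a ha => by
    obtain ⟨b, hb, hbΦ⟩ := mem_code_iff.1 (hΦ _ (mem_code_iff.2 ⟨a, ha, rfl⟩))
    exact ⟨b, (mem_setA_iff (by omega)).1 hb, hbΦ⟩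
  -- `Φ` is the left multiplication by some `b` of degree less than `lm`
  obtain ⟨b, hbdeg, hb⟩ : ∃ b, SkewPoly.DegLT (l * m) b ∧ leftMul C f b = Φ := by
    rcases eq_or_ne ν 0 with rfl | hν
    -- For `ν = 0` the element `1 + νt^{lm}` is 1, so `Φ` itself lies in the code.
    · obtain ⟨b, ⟨hb1, hb2⟩, hb⟩ := hΦA _ (one_add_mem_setA (by omega))
      refine ⟨b, fun i hi => ?_, ?_⟩
      · rcases hi.eq_or_lt with rfl | hi
        · rw [hb2, zero_mul]
        · exact hb1 i hi
      · rw [hb, map_zero, add_zero, map_one, map_one, mul_one]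
    · obtain ⟨a, ⟨ha1, ha2⟩, ha⟩ := hΦA _ (t_pow_mem_setA (i := 1) (by omega) (by omega))
      obtain ⟨a', ⟨ha1', ha2'⟩, ha'⟩ := hΦA _ (t_pow_mem_setA (i := 2) (by omega) (by omega))
      have haa : a * SkewPoly.t σ ^ 1 = a' := eq_of_leftMul_eq hinj
        (by rw [map_mul, ha, ha', mul_assoc, ← map_mul, ← pow_add]) (degLT_mul_t_pow ha1 1) ha1'
        (by omega) (by omega)
      -- The coefficient of `at = a'` at `lm + 1`, beyond the degree of `a'`.
      have hlast : a.coeff (l * m) = 0 := by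
        have h := ha1' (l * m + 1) le_rfl
        rwa [← haa, SkewPoly.coeff_mul_t_pow, if_pos (by omega), Nat.add_sub_cancel] at h
      have h0 : a.coeff 0 = 0 := by
        rw [hlast] at ha2
        simpa [hν] using ha2.symm
      obtain ⟨b, hbdeg, rfl⟩ := SkewPoly.eq_mul_t_of_coeff_zero ha1 h0
      refine ⟨b, hbdeg, LinearMap.ext fun v => ?_⟩
      obtain ⟨w, rfl⟩ := ht v
      rw [map_mul, pow_one] at ha
      exact LinearMap.congr_fun ha w
  have hbconst : b = SkewPoly.const σ (b.coeff 0) := by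
    obtain ⟨a, ⟨ha1, ha2⟩, ha⟩ := hΦA _ (t_pow_mem_setA (i := l * m - 1) (by omega) (by omega))
    have hba : b * SkewPoly.t σ ^ (l * m - 1) = a := eq_of_leftMul_eq hinj
      (by rw [map_mul, hb, ha]) (degLT_mul_t_pow hbdeg _) ha1 (by omega) (by omega)
    have hcoeff := fun i => SkewPoly.coeff_mul_t_pow b (l * m - 1) i
    rw [hba] at hcoeff
    refine SkewPoly.DegLT.eq_const fun i hi => ?_
    have h := hcoeff (l * m - 1 + i)
    rw [if_pos (by omega), Nat.add_sub_cancel_left] at h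
    rw [← h]
    -- For `i = 1` the coefficient sits at `lm`, where the degree bound says nothing; there it is
    -- `νρ` of the constant term, which is zero because `lm - 1 > 0`.
    rcases hi.eq_or_lt with rfl | hi
    · rw [show l * m - 1 + 1 = l * m by omega, ha2, hcoeff 0, if_neg (by omega), map_zero, mul_zero]
    · exact ha1 _ (by omega)
  rw [hbconst] at hb
  refine ⟨b.coeff 0, hb, ?_⟩
  obtain ⟨a, ⟨ha1, ha2⟩, ha⟩ := hΦA _ (one_add_mem_setA (by omega))
  have hcoeff : ∀ i, (SkewPoly.const σ (b.coeff 0) *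
      (SkewPoly.const σ 1 + SkewPoly.monomial σ (l * m) ν)).coeff i =
      b.coeff 0 * ((if i = 0 then 1 else 0) + if l * m = i then ν else 0) := fun i => by
    rw [SkewPoly.coeff_const_mul, SkewPoly.coeff_add, SkewPoly.coeff_const, SkewPoly.coeff_monomial]
  have hba := eq_of_leftMul_eq hinj (a := SkewPoly.const σ (b.coeff 0) *
      (SkewPoly.const σ 1 + SkewPoly.monomial σ (l * m) ν)) (by rw [map_mul, hb, ha])
    (fun i (hi : l * m + 1 ≤ i) => by
      rw [hcoeff, if_neg (by omega), if_neg (by omega), add_zero, mul_zero]) ha1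
    (by omega) (by omega)
  rw [← hba, hcoeff, hcoeff, if_neg (by omega), if_pos rfl, if_pos rfl, if_neg (by omega),
    zero_add, add_zero, mul_one] at ha2
  exact ha2

/-- Mirror image of the left case: `t` is split off on the left and cancelled by injectivity of
`L_t`. Right multiplication of `νt^{lm}` by `c` yields `νσ^{lm}(c)`, whence the twist; for `ν = 0`
there is no condition. -/
theorem exists_const_of_mem_code_mul (hlm : 2 < l * m) (hB : 2 * (l * m) ≤ B)
    (ht : Function.Injective (leftMul C f (SkewPoly.t σ)))
    (hinj : ∀ a, leftMul C f a = 0 → SkewPoly.DegLT B a → a = 0)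
    {Φ : Module.End (fixF C σ) (Vf f)}
    (hΦ : ∀ M ∈ code C ρ ν l m f, M * Φ ∈ code C ρ ν l m f) :
    ∃ c, leftMul C f (SkewPoly.const σ c) = Φ ∧
      (ν ≠ 0 → (σ ^ (l * m) : D ≃+* D) c = ρ c) := by
  have hΦA : ∀ a ∈ setA C σ ρ ν l m, ∃ b, (SkewPoly.DegLT (l * m + 1) b ∧
      b.coeff (l * m) = ν * ρ (b.coeff 0)) ∧ leftMul C f b = leftMul C f a * Φ := fun a ha => by
    obtain ⟨b, hb, hbΦ⟩ := mem_code_iff.1 (hΦ _ (mem_code_iff.2 ⟨a, ha, rfl⟩))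
    exact ⟨b, (mem_setA_iff (by omega)).1 hb, hbΦ⟩
  -- `Φ` is the left multiplication by some `b` of degree less than `lm`
  obtain ⟨b, hbdeg, hb⟩ : ∃ b, SkewPoly.DegLT (l * m) b ∧ leftMul C f b = Φ := by
    rcases eq_or_ne ν 0 with rfl | hν
    · obtain ⟨b, ⟨hb1, hb2⟩, hb⟩ := hΦA _ (one_add_mem_setA (by omega))
      refine ⟨b, fun i hi => ?_, ?_⟩
      · rcases hi.eq_or_lt with rfl | hi
        · rw [hb2, zero_mul]
        · exact hb1 i hi
      · rw [hb, map_zero, add_zero, map_one, map_one, one_mul]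
    · obtain ⟨a, ⟨ha1, ha2⟩, ha⟩ := hΦA _ (t_pow_mem_setA (i := 1) (by omega) (by omega))
      obtain ⟨a', ⟨ha1', ha2'⟩, ha'⟩ := hΦA _ (t_pow_mem_setA (i := 2) (by omega) (by omega))
      have haa : SkewPoly.t σ ^ 1 * a = a' := eq_of_leftMul_eq hinj
        (by rw [map_mul, ha, ha', ← mul_assoc, ← map_mul, ← pow_add]) (degLT_t_pow_mul ha1 1) ha1'
        (by omega) (by omega)
      have hlast : a.coeff (l * m) = 0 := by
        have h := ha1' (l * m + 1) le_rfl
        rw [← haa, SkewPoly.coeff_t_pow_mul, if_pos (by omega), Nat.add_sub_cancel] at h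
        exact (map_eq_zero_iff _ (RingEquiv.injective _)).1 h
      have h0 : a.coeff 0 = 0 := by
        rw [hlast] at ha2
        simpa [hν] using ha2.symm
      obtain ⟨b, hbdeg, rfl⟩ := SkewPoly.eq_t_mul_of_coeff_zero ha1 h0
      refine ⟨b, hbdeg, LinearMap.ext fun v => ht ?_⟩
      rw [map_mul, pow_one] at ha
      exact LinearMap.congr_fun ha v
  have hbconst : b = SkewPoly.const σ (b.coeff 0) := by
    obtain ⟨a, ⟨ha1, ha2⟩, ha⟩ := hΦA _ (t_pow_mem_setA (i := l * m - 1) (by omega) (by omega))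
    have hba : SkewPoly.t σ ^ (l * m - 1) * b = a := eq_of_leftMul_eq hinj
      (by rw [map_mul, hb, ha]) (degLT_t_pow_mul hbdeg _) ha1 (by omega) (by omega)
    have hcoeff := fun i => SkewPoly.coeff_t_pow_mul b (l * m - 1) i
    rw [hba] at hcoeff
    refine SkewPoly.DegLT.eq_const fun i hi => ?_
    have h := hcoeff (l * m - 1 + i)
    rw [if_pos (by omega), Nat.add_sub_cancel_left] at h
    rw [← map_eq_zero_iff _ (RingEquiv.injective (σ ^ (l * m - 1) : D ≃+* D)), ← h]
    rcases hi.eq_or_lt with rfl | hi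
    · rw [show l * m - 1 + 1 = l * m by omega, ha2, hcoeff 0, if_neg (by omega), map_zero, mul_zero]
    · exact ha1 _ (by omega)
  rw [hbconst] at hb
  refine ⟨b.coeff 0, hb, fun hν => ?_⟩
  obtain ⟨a, ⟨ha1, ha2⟩, ha⟩ := hΦA _ (one_add_mem_setA (by omega))
  have hcoeff : ∀ i, ((SkewPoly.const σ 1 + SkewPoly.monomial σ (l * m) ν) *
      SkewPoly.const σ (b.coeff 0)).coeff i =
      ((if i = 0 then 1 else 0) + if l * m = i then ν else 0) *
        (σ ^ i : D ≃+* D) (b.coeff 0) := fun i => by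
    rw [SkewPoly.coeff_mul_const, SkewPoly.coeff_add, SkewPoly.coeff_const, SkewPoly.coeff_monomial]
  have hba := eq_of_leftMul_eq hinj
    (a := (SkewPoly.const σ 1 + SkewPoly.monomial σ (l * m) ν) * SkewPoly.const σ (b.coeff 0))
    (by rw [map_mul, hb, ha])
    (fun i (hi : l * m + 1 ≤ i) => by
      rw [hcoeff, if_neg (by omega), if_neg (by omega), add_zero, zero_mul]) ha1
    (by omega) (by omega)
  rw [← hba, hcoeff, hcoeff, if_neg (by omega), if_pos rfl, if_pos rfl, if_neg (by omega),
    zero_add, add_zero, one_mul, pow_zero, RingAut.one_apply] at ha2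
  exact mul_left_cancel₀ hν ha2

theorem const_mul_mem_code (h : 0 < l * m) {c : D} (hc : c * ν = ν * ρ c)
    {M : Module.End (fixF C σ) (Vf f)} (hM : M ∈ code C ρ ν l m f) :
    leftMul C f (SkewPoly.const σ c) * M ∈ code C ρ ν l m f := by
  obtain ⟨a, ha, rfl⟩ := mem_code_iff.1 hM
  obtain ⟨ha1, ha2⟩ := (mem_setA_iff h).1 ha
  refine mem_code_iff.2 ⟨SkewPoly.const σ c * a, (mem_setA_iff h).2 ⟨fun i hi => ?_, ?_⟩,
    map_mul _ _ _⟩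
  · rw [SkewPoly.coeff_const_mul, ha1 i hi, mul_zero]
  · rw [SkewPoly.coeff_const_mul, SkewPoly.coeff_const_mul, ha2, map_mul, ← mul_assoc, hc,
      mul_assoc]

theorem mul_const_mem_code (h : 0 < l * m) {c : D}
    (hc : ν ≠ 0 → (σ ^ (l * m) : D ≃+* D) c = ρ c)
    {M : Module.End (fixF C σ) (Vf f)} (hM : M ∈ code C ρ ν l m f) :
    M * leftMul C f (SkewPoly.const σ c) ∈ code C ρ ν l m f := by
  obtain ⟨a, ha, rfl⟩ := mem_code_iff.1 hM
  obtain ⟨ha1, ha2⟩ := (mem_setA_iff h).1 ha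
  refine mem_code_iff.2 ⟨a * SkewPoly.const σ c, (mem_setA_iff h).2 ⟨fun i hi => ?_, ?_⟩,
    map_mul _ _ _⟩
  · rw [SkewPoly.coeff_mul_const, ha1 i hi, zero_mul]
  · rw [SkewPoly.coeff_mul_const, SkewPoly.coeff_mul_const, ha2, map_mul, pow_zero,
      RingAut.one_apply, ← mul_assoc]
    rcases eq_or_ne ν 0 with rfl | hν
    · simp
    · rw [hc hν]

/-- What commutes with the code commutes with the action of all of `R`. -/
theorem commute_leftMul_of_commute_code (hlm : 2 < l * m)
    (ht : Function.Surjective (leftMul C f (SkewPoly.t σ)))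
    {Φ : Module.End (fixF C σ) (Vf f)} (hΦ : ∀ M ∈ code C ρ ν l m f, M * Φ = Φ * M)
    (a : SkewPoly σ) : Φ * leftMul C f a = leftMul C f a * Φ := by
  have htΦ : leftMul C f (SkewPoly.t σ) * Φ = Φ * leftMul C f (SkewPoly.t σ) := by
    have h := hΦ _ (mem_code_iff.2 ⟨_, t_pow_mem_setA (i := 1) (by omega) (by omega), rfl⟩)
    rwa [pow_one] at h
  have hconst : ∀ c : D, leftMul C f (SkewPoly.const σ c) * Φ =
      Φ * leftMul C f (SkewPoly.const σ c) := fun c => by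
    -- The constant `c` need not lie in `A`, but `ct` does as `lm > 1`; afterwards `t` is cancelled.
    have hmem : SkewPoly.const σ c * SkewPoly.t σ ^ 1 ∈ setA C σ ρ ν l m := by
      rw [mem_setA_iff (by omega)]
      simp only [SkewPoly.DegLT, SkewPoly.coeff_const_mul, SkewPoly.coeff_t_pow]
      refine ⟨fun i hi => ?_, ?_⟩
      · rw [if_neg (by omega), mul_zero]
      · rw [if_neg (by omega), if_neg (by omega), mul_zero, map_zero, mul_zero]
    have h := hΦ _ (mem_code_iff.2 ⟨_, hmem, rfl⟩)
    rw [pow_one, map_mul, mul_assoc, htΦ, ← mul_assoc, ← mul_assoc] at h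
    refine LinearMap.ext fun v => ?_
    obtain ⟨w, rfl⟩ := ht v
    exact LinearMap.congr_fun h w
  induction a using SkewPoly.induction with
  | h0 => simp
  | ha i c q hq =>
    have htpow := Commute.pow_right (show Commute Φ (leftMul C f (SkewPoly.t σ)) from htΦ.symm) i
    rw [map_add, mul_add, add_mul, hq, SkewPoly.monomial_eq, map_mul, map_pow]
    exact congrArg (· + _) (Commute.mul_right (hconst c).symm htpow)

/-- Commuting with the constants makes `c` central, and commuting with `t` makes it fixed by `σ`. -/
theorem exists_algebraMap_eq_of_commute [Algebra.IsCentral C D] (hB : 2 ≤ B)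
    (hinj : ∀ a, leftMul C f a = 0 → SkewPoly.DegLT B a → a = 0) {c : D}
    (hc : ∀ a, leftMul C f (SkewPoly.const σ c) * leftMul C f a =
      leftMul C f a * leftMul C f (SkewPoly.const σ c)) :
    ∃ e : fixF C σ, algebraMap (fixF C σ) D e = c := by
  have hcenter : c ∈ Subalgebra.center C D := by
    rw [Subalgebra.mem_center_iff]
    intro z
    have hdeg : ∀ z : D, SkewPoly.DegLT 1 (SkewPoly.const σ z) := fun z i hi => by
      rw [SkewPoly.coeff_const, if_neg (by omega)]
    have h := eq_of_leftMul_eq hinj (a := SkewPoly.const σ (c * z)) (b := SkewPoly.const σ (z * c))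
      (by rw [map_mul, map_mul, map_mul, map_mul, hc]) (hdeg _) (hdeg _) (by omega) (by omega)
    have h0 := congrArg (fun p => SkewPoly.coeff p 0) h
    simp only [SkewPoly.coeff_const, if_true] at h0
    exact h0.symm
  rw [Algebra.IsCentral.center_eq_bot, Algebra.mem_bot] at hcenter
  obtain ⟨e, rfl⟩ := hcenter
  refine ⟨⟨e, ?_⟩, rfl⟩
  show σ (algebraMap C D e) = algebraMap C D e
  have hdeg : ∀ z : D, SkewPoly.DegLT 2 (SkewPoly.const σ z * SkewPoly.t σ ^ 1) := fun z i hi => by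
    rw [SkewPoly.coeff_const_mul, SkewPoly.coeff_t_pow, if_neg (by omega), mul_zero]
  have h := eq_of_leftMul_eq hinj (a := SkewPoly.const σ (σ (algebraMap C D e)) * SkewPoly.t σ ^ 1)
    (b := SkewPoly.const σ (algebraMap C D e) * SkewPoly.t σ ^ 1)
    (by rw [pow_one, ← SkewPoly.t_mul_const, map_mul, map_mul, hc]) (hdeg _) (hdeg _) hB hB
  have h1 := congrArg (fun p => SkewPoly.coeff p 1) h
  simpa only [SkewPoly.coeff_const_mul, SkewPoly.coeff_t_pow, if_true, mul_one] using h1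

variable (C ρ) in
/-- The action of the constants on `V_f`, over `F'`. -/
def constEnd (f : SkewPoly σ) : D →ₐ[fixF' C σ ρ] Module.End (fixF C σ) (Vf f) where
  toRingHom := (leftMul C f).toRingHom.comp (SkewPoly.const σ)
  commutes' c := (leftMul C f).commutes (c : fixF C σ)

theorem constEnd_injective [Nontrivial (Vf f)] : Function.Injective (constEnd C ρ f) :=
  (constEnd C ρ f).toRingHom.injective

end CodeIdealisers

end SkewCode

end

/-! ### The main theorem -/

theorem mainTheorem8
    {C D : Type*} [Field C] [DivisionRing D] [Algebra C D]
    -- `D` is a central division algebra of degree `d` over `C`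
    [Algebra.IsCentral C D] [FiniteDimensional C D]
    (d : ℕ) (hd : Module.finrank C D = d ^ 2)
    -- `σ` has finite order `n > 1` modulo inner automorphisms, with `σⁿ(z) = u z u⁻¹`, `σ(u) = u`
    (σ : D ≃+* D) (n : ℕ) (hn : 1 < n)
    (u : D) (hu : u ≠ 0) (hσn : ∀ z : D, (σ ^ n : D ≃+* D) z = u * z * u⁻¹) (hσu : σ u = u)
    (hσ : ∀ j : ℕ, 0 < j → j < n → ¬ SkewCode.IsInnerAut (σ ^ j : D ≃+* D))
    -- `ρ` is an automorphism of `D` such that `F / F'` is finite-dimensional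
    (ρ : D ≃+* D) [FiniteDimensional (SkewCode.fixF' C σ ρ) (SkewCode.fixF C σ)]
    (ν : D)
    -- `f` is monic irreducible of degree `m > 1` with `(f,t)_r = 1`
    (m l : ℕ) (hm : 1 < m)
    (f : SkewCode.SkewPoly σ) (hfdeg : f.degree = m) (hfmonic : f.coeff m = 1)
    (hf : Irreducible f) (hft : SkewCode.RightCoprime f (SkewCode.SkewPoly.t σ))
    -- `h(t) = ĥ(u⁻¹tⁿ)` is the minimal central left multiple of `f`, and `deg h = dmn`
    (hhat : Polynomial (SkewCode.fixF C σ)) (hmclm : SkewCode.IsMCLM u n f hhat)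
    (hdeg : (SkewCode.evalCentral σ u n hhat).degree = (d * m * n : ℕ))
    (hl : 2 * l ≤ d * n) (hlm : 2 < l * m)
    -- the ambient algebra of endomorphisms: `End_{E_f}(V_f)`, `End_F(V_f)`, or any in between
    (𝓔 : Subalgebra (SkewCode.fixF C σ) (Module.End (SkewCode.fixF C σ) (SkewCode.Vf f)))
    (h𝓔 : SkewCode.endEf C u n f ≤ 𝓔) :
    -- the code is a set of `E_f`-linear maps
    (∀ Φ ∈ SkewCode.code C ρ ν l m f, Φ ∈ SkewCode.endEf C u n f) ∧
    (ν ≠ 0 →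
      Nonempty (SkewCode.leftIdealiser (𝓔.restrictScalars (SkewCode.fixF' C σ ρ))
          (SkewCode.code C ρ ν l m f) ≃ₐ[SkewCode.fixF' C σ ρ] SkewCode.twistedFix C σ ρ ν) ∧
      (ν ∈ Set.range (algebraMap C D) →
        Nonempty (SkewCode.leftIdealiser (𝓔.restrictScalars (SkewCode.fixF' C σ ρ))
          (SkewCode.code C ρ ν l m f) ≃ₐ[SkewCode.fixF' C σ ρ] SkewCode.fixRho C σ ρ)) ∧
      Nonempty (SkewCode.rightIdealiser (𝓔.restrictScalars (SkewCode.fixF' C σ ρ))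
          (SkewCode.code C ρ ν l m f) ≃ₐ[SkewCode.fixF' C σ ρ]
            SkewCode.fixRhoInvSigmaPow C σ ρ (l * m)) ∧
      Nonempty (SkewCode.centraliser 𝓔 (SkewCode.code C ρ ν l m f)
          ≃ₐ[SkewCode.fixF C σ] AdjoinRoot hhat) ∧
      Nonempty (SkewCode.centre (𝓔.restrictScalars (SkewCode.fixF' C σ ρ))
          (SkewCode.code C ρ ν l m f) ≃ₐ[SkewCode.fixF' C σ ρ] SkewCode.fixF' C σ ρ)) ∧
    (ν = 0 →
      Nonempty (SkewCode.leftIdealiser (𝓔.restrictScalars (SkewCode.fixF' C σ ρ))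
          (SkewCode.code C ρ ν l m f) ≃ₐ[SkewCode.fixF' C σ ρ] D) ∧
      Nonempty (SkewCode.rightIdealiser (𝓔.restrictScalars (SkewCode.fixF' C σ ρ))
          (SkewCode.code C ρ ν l m f) ≃ₐ[SkewCode.fixF' C σ ρ] D) ∧
      Nonempty (SkewCode.centraliser 𝓔 (SkewCode.code C ρ ν l m f)
          ≃ₐ[SkewCode.fixF C σ] AdjoinRoot hhat) ∧
      Nonempty (SkewCode.centre (𝓔.restrictScalars (SkewCode.fixF' C σ ρ))
          (SkewCode.code C ρ ν l m f) ≃ₐ[SkewCode.fixF' C σ ρ] SkewCode.fixF C σ)) := by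
  open SkewCode in
  have hn0 : 0 < n := by omega
  have := isSimpleModule_Vf hf
  have : Nontrivial (Vf f) := IsSimpleModule.nontrivial (SkewPoly σ) (Vf f)
  have hbij := bijective_leftMul_t (C := C) hf hft
  have hndeg := natDegree_mul_eq_of_degree_evalCentral hn0 hu hσu hmclm.monic.ne_zero hdeg
  have hnat : hhat.natDegree = d * m := Nat.eq_of_mul_eq_mul_left hn0 (by rw [hndeg]; ring)
  have hinj : ∀ a, leftMul C f a = 0 → SkewPoly.DegLT (d * m * n) a → a = 0 := fun a ha hk =>
    eq_zero_of_leftMul_eq_zero hn0 hu hσn hσu hσ hbij.2 hmclm ha (by rwa [hndeg])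
  have hB : 2 * (l * m) ≤ d * m * n := by
    calc 2 * (l * m) = 2 * l * m := by ring
      _ ≤ d * n * m := Nat.mul_le_mul_right m hl
      _ = d * m * n := by ring
  have hlm0 : 0 < l * m := by omega
  have hL𝓔 : ∀ a, leftMul C f a ∈ 𝓔 := fun a => h𝓔 (leftMul_mem_endEf hu hσn hσu a)
  have hcode : ∀ Φ ∈ code C ρ ν l m f, Φ ∈ endEf C u n f := by
    intro Φ hΦ
    obtain ⟨a, -, rfl⟩ := mem_code_iff.1 hΦ
    exact leftMul_mem_endEf hu hσn hσu a
  have hψ : Function.Injective (constEnd C ρ f) := constEnd_injective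
  have hleft : (twistedFix C σ ρ ν).map (constEnd C ρ f) =
      leftIdealiser (𝓔.restrictScalars (fixF' C σ ρ)) (code C ρ ν l m f) := by
    ext Φ
    constructor
    · rintro ⟨c, hc, rfl⟩
      exact ⟨hL𝓔 _, fun M hM => const_mul_mem_code hlm0 hc hM⟩
    · rintro ⟨-, hΦ⟩
      obtain ⟨c, hc, hcν⟩ := exists_const_of_mul_mem_code hlm hB hbij.2 hinj hΦ
      exact ⟨c, hcν, hc⟩
  -- Kept general in `S` to serve both cases: `Fix(ρ⁻¹ ∘ σ^{lm})` for `ν ≠ 0` and all of `D` for `ν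
  -- = 0`.
  have hright : ∀ S : Subalgebra (fixF' C σ ρ) D,
      (∀ c, c ∈ S ↔ (ν ≠ 0 → (σ ^ (l * m) : D ≃+* D) c = ρ c)) → S.map (constEnd C ρ f) =
      rightIdealiser (𝓔.restrictScalars (fixF' C σ ρ)) (code C ρ ν l m f) := by
    intro S hS
    ext Φ
    constructor
    · rintro ⟨c, hc, rfl⟩
      exact ⟨hL𝓔 _, fun M hM => mul_const_mem_code hlm0 ((hS c).1 hc) hM⟩
    · rintro ⟨-, hΦ⟩
      obtain ⟨c, hc, hcν⟩ := exists_const_of_mem_code_mul hlm hB hbij.1 hinj hΦ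
      exact ⟨c, (hS c).2 hcν, hc⟩
  have hcentre : ∀ Φ, Φ ∈ centre (𝓔.restrictScalars (fixF' C σ ρ)) (code C ρ ν l m f) ↔
      ∃ e : fixF C σ, (ν ≠ 0 → e ∈ fixF' C σ ρ) ∧
        algebraMap (fixF C σ) (Module.End (fixF C σ) (Vf f)) e = Φ := by
    intro Φ
    constructor
    · rintro ⟨⟨-, hΦ⟩, -, hΦc⟩
      obtain ⟨c, rfl, hcν⟩ := exists_const_of_mul_mem_code hlm hB hbij.2 hinj hΦ
      obtain ⟨e, rfl⟩ := exists_algebraMap_eq_of_commute (by omega) hinj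
        (commute_leftMul_of_commute_code hlm hbij.2 hΦc)
      refine ⟨e, fun hν => ?_, ((leftMul C f).commutes e).symm⟩
      -- As `e` is central, `eν = νρ(e)` becomes `νe = νρ(e)`, and `ν` cancels.
      rw [Algebra.commutes] at hcν
      exact (mul_left_cancel₀ hν hcν).symm
    · rintro ⟨e, he, rfl⟩
      refine ⟨⟨𝓔.algebraMap_mem e, fun M hM => ?_⟩, 𝓔.algebraMap_mem e, fun M hM =>
        (Algebra.commutes e M).symm⟩
      rw [← (leftMul C f).commutes e]
      refine const_mul_mem_code hlm0 ?_ hM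
      rcases eq_or_ne ν 0 with rfl | hν
      · simp
      · rw [show ρ (algebraMap (fixF C σ) D e) = algebraMap (fixF C σ) D e from he hν,
          Algebra.commutes]
  have h0 : evalEnd C u n f hhat = 0 :=
    (leftMul_evalCentral_eq_zero_iff_dvd hu hσn hσu hmclm hhat).2 dvd_rfl
  have : Fact (Irreducible hhat) := ⟨irreducible_of_isMCLM hu hσn hσu hf hmclm⟩
  have hE : (adjoinRootEnd u n f hhat h0).range = centraliser 𝓔 (code C ρ ν l m f) := by
    ext Φ
    constructor
    · rintro ⟨e, rfl⟩
      induction e using AdjoinRoot.induction_on with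
      | _ p =>
        refine ⟨hL𝓔 _, fun M hM => ?_⟩
        obtain ⟨a, -, rfl⟩ := mem_code_iff.1 hM
        show leftMul C f a * leftMul C f (evalCentral σ u n p) =
          leftMul C f (evalCentral σ u n p) * leftMul C f a
        rw [← map_mul, ← map_mul, (commute_evalCentral hu hσn hσu p a).eq]
    · rintro ⟨-, hΦ⟩
      exact exists_adjoinRootEnd_eq_of_commute hd hn0 hu hσn hσu hσ hf hbij.2
        (SkewPoly.degLT_of_degree_eq hfdeg) (by rw [hfmonic]; exact one_ne_zero) hmclm hnat h0
        (commute_leftMul_of_commute_code hlm hbij.2 hΦ)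
  have hEiso : Nonempty (centraliser 𝓔 (code C ρ ν l m f) ≃ₐ[fixF C σ] AdjoinRoot hhat) :=
    ⟨((AlgEquiv.ofInjective _ (adjoinRootEnd u n f hhat h0).toRingHom.injective).trans
      (Subalgebra.equivOfEq _ _ hE)).symm⟩
  have hleftiso := ((twistedFix C σ ρ ν).equivMapOfInjective _ hψ).trans
    (Subalgebra.equivOfEq _ _ hleft)
  refine ⟨hcode, fun hν => ⟨⟨hleftiso.symm⟩, fun hνC => ?_, ?_, hEiso, ?_⟩,
    fun hν => ⟨?_, ?_, hEiso, ?_⟩⟩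
  · have heq : twistedFix C σ ρ ν = fixRho C σ ρ := by
      obtain ⟨z, rfl⟩ := hνC
      ext c
      show c * algebraMap C D z = algebraMap C D z * ρ c ↔ ρ c = c
      rw [← Algebra.commutes, mul_right_inj' hν, eq_comm]
    exact ⟨hleftiso.symm.trans (Subalgebra.equivOfEq _ _ heq)⟩
  · refine ⟨(((fixRhoInvSigmaPow C σ ρ (l * m)).equivMapOfInjective _ hψ).trans
      (Subalgebra.equivOfEq _ _ (hright _ fun c => ?_))).symm⟩
    show ρ.symm ((σ ^ (l * m) : D ≃+* D) c) = c ↔ _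
    rw [RingEquiv.symm_apply_eq]
    exact ⟨fun h _ => h, fun h => h hν⟩
  · let φ := Algebra.ofId (fixF' C σ ρ) (Module.End (fixF C σ) (Vf f))
    refine ⟨((AlgEquiv.ofInjective φ φ.toRingHom.injective).trans
      (Subalgebra.equivOfEq _ _ ?_)).symm⟩
    ext Φ
    rw [hcentre]
    exact ⟨fun ⟨e, he⟩ => ⟨e, fun _ => e.2, he⟩, fun ⟨e, he, h⟩ => ⟨⟨e, he hν⟩, h⟩⟩
  · have heq : twistedFix C σ ρ ν = ⊤ := by
      refine eq_top_iff.2 fun c _ => ?_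
      show c * ν = ν * ρ c
      rw [hν, mul_zero, zero_mul]
    exact ⟨hleftiso.symm.trans ((Subalgebra.equivOfEq _ _ heq).trans Subalgebra.topEquiv)⟩
  · exact ⟨((Subalgebra.topEquiv.symm.trans (Subalgebra.equivMapOfInjective ⊤ _ hψ)).trans
      (Subalgebra.equivOfEq _ _ (hright _ fun c =>
        ⟨fun _ h => absurd hν h, fun _ => Algebra.mem_top⟩))).symm⟩
  · let φ := (Algebra.ofId (fixF C σ) (Module.End (fixF C σ) (Vf f))).restrictScalars
      (fixF' C σ ρ)
    refine ⟨((AlgEquiv.ofInjective φ φ.toRingHom.injective).trans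
      (Subalgebra.equivOfEq _ _ ?_)).symm⟩
    ext Φ
    rw [hcentre]
    exact ⟨fun ⟨e, he⟩ => ⟨e, fun h => absurd hν h, he⟩, fun ⟨e, _, h⟩ => ⟨e, h⟩⟩
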